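/- Let $X$ be a locally finite simplicial complex all of whose maximal simplices have the same dimension $n$, and suppose that $X$ and the complement in $X$ of its $(n-2)$-skeleton are connected. Suppose each closed $n$-simplex $s$ of $X$ carries a Riemannian metric $g_s$; it is enough that, in affine coordinates, $g_s$ is continuous on the open simplex and bounded there above and below by positive multiples of the Euclidean metric, and no compatibility between the metrics of different simplices is required. (Such an $(X,g)$ is called an admissible Riemannian polyhedron.) Let $d$ be the intrinsic distance of $X$: $d(x,y)$ is the infimum of the $g$-lengths of all finite concatenations of $C^1$ paths from $x$ to $y$, each of which lies in one closed $n$-simplex and runs, except possibly for its endpoints, in its interior. Let $\mu$ be the Riemannian volume measure of $X$, that is, the sum of the Riemannian volume measures of the $n$-simplices. Assume that $(X,d)$ is complete. Let $1<p<\infty$ and let $f:X\to\mathbb R$ be a locally Lipschitz, non-negative function with $f\in L^p(X,\mu)$ which is weakly subharmonic, i.e. $$\int_X\langle\nabla\varphi,\nabla f\rangle\,d\mu=\sum_{s}\int_{s}\langle\nabla\varphi,\nabla f\rangle_{g_s}\,d\mu_{g_s}\le 0$$ for every non-negative Lipschitz function $\varphi:X\to\mathbb R$ with compact support, where $s$ runs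 over the $n$-simplices of $X$. Then $f$ is constant. -/

import Mathlib

open scoped ENNReal NNReal Matrix
open MeasureTheory Set

/-- The closed coordinate simplex `t i ≥ 0`, `∑ t i ≤ 1` in `ℝⁿ`. -/
def closedSimplex (n : ℕ) : Set (EuclideanSpace ℝ (Fin n)) :=
  {t | (∀ i, 0 ≤ t i) ∧ ∑ i, t i ≤ 1}

/-- The open coordinate simplex `t i > 0`, `∑ t i < 1` in `ℝⁿ`. -/
def openSimplex (n : ℕ) : Set (EuclideanSpace ℝ (Fin n)) :=
  {t | (∀ i, 0 < t i) ∧ ∑ i, t i < 1}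

theorem openSimplex_subset (n : ℕ) : openSimplex n ⊆ closedSimplex n :=
  fun _ h => ⟨fun i => (h.1 i).le, h.2.le⟩

/-- A locally finite simplicial complex (in an arbitrary real vector space `E`, which is only
used to name the points), all of whose maximal simplices have dimension `n`, together with a
Riemannian metric on each `n`-simplex. The vertices of each `n`-simplex are enumerated, which
identifies the simplex affinely with the coordinate simplex in `ℝⁿ`; the Riemannian metric is
given by its matrix `(g i j)` in these coordinates. It is continuous on the open simplex
(in particular it may be smooth) and it is uniformly equivalent there to the Euclidean metric,
as is automatic for a Riemannian metric on the closed simplex. No compatibility between the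
metrics of different simplices is required. -/
structure RiemannianPolyhedron (E : Type*) [AddCommGroup E] [Module ℝ E] (n : ℕ) where
  complex : Geometry.SimplicialComplex ℝ E
  locallyFinite : ∀ v ∈ complex.vertices, {s ∈ complex.faces | v ∈ s}.Finite
  /-- Enumeration of the vertices; so each maximal simplex has exactly `n + 1` vertices. -/
  vertex : ∀ s : complex.facets, Fin (n + 1) ≃ {v : E // v ∈ (s : Finset E)}
  metric : complex.facets → EuclideanSpace ℝ (Fin n) → Matrix (Fin n) (Fin n) ℝ
  metric_symm : ∀ s, ∀ t ∈ openSimplex n, (metric s t).IsSymm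
  metric_continuous : ∀ s, ContinuousOn (metric s) (openSimplex n)
  metric_elliptic : ∀ s, ∃ c : ℝ, 0 < c ∧ ∃ C : ℝ, ∀ t ∈ openSimplex n, ∀ v : Fin n → ℝ,
    c * (v ⬝ᵥ v) ≤ v ⬝ᵥ (metric s t *ᵥ v) ∧ v ⬝ᵥ (metric s t *ᵥ v) ≤ C * (v ⬝ᵥ v)

namespace RiemannianPolyhedron

variable {E : Type*} [AddCommGroup E] [Module ℝ E] {n : ℕ}

/-- The points of the polyhedron. -/
def Carrier (X : RiemannianPolyhedron E n) : Type _ := {x : E // x ∈ X.complex.space}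

instance : CoeSort (RiemannianPolyhedron E n) (Type _) := ⟨Carrier⟩

variable (X : RiemannianPolyhedron E n)

/-- The affine parametrization of the simplex `s`. -/
def chart (s : X.complex.facets) (t : EuclideanSpace ℝ (Fin n)) : E :=
  (1 - ∑ i, t i) • (X.vertex s 0 : E) + ∑ i, t i • (X.vertex s i.succ : E)

theorem chart_mem (s : X.complex.facets) {t : EuclideanSpace ℝ (Fin n)}
    (ht : t ∈ closedSimplex n) : X.chart s t ∈ X.complex.space := by
  apply X.complex.convexHull_subset_space (X.complex.facets_subset s.2)
  have hv : ∀ i, (X.vertex s i : E) ∈ convexHull ℝ ((s : Finset E) : Set E) :=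
    fun i => subset_convexHull ℝ _ (X.vertex s i).2
  have h := (convex_convexHull ℝ ((s : Finset E) : Set E)).sum_mem (t := Finset.univ)
    (w := fun i : Fin (n + 1) => Fin.cases (1 - ∑ j, t j) (fun j => t j) i)
    (z := fun i => (X.vertex s i : E))
    (by
      intro i _
      refine Fin.cases ?_ (fun j => ?_) i
      · simpa using ht.2
      · simpa using ht.1 j)
    (by simp [Fin.sum_univ_succ]) (fun i _ => hv i)
  simpa [chart, Fin.sum_univ_succ] using h

/-- The affine parametrization of the closed simplex `s`, with values in the polyhedron. -/
def point (s : X.complex.facets) (t : closedSimplex n) : X := ⟨X.chart s t, X.chart_mem s t.2⟩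

/-! Paths and the intrinsic distance. -/

/-- The length `∫₀¹ (g(γ', γ'))^(1/2)` of a curve for the metric of the simplex `s`. -/
noncomputable def length (s : X.complex.facets) (γ : ℝ → EuclideanSpace ℝ (Fin n)) : ℝ≥0∞ :=
  ∫⁻ r in Ioo (0 : ℝ) 1, ENNReal.ofReal
    √((deriv γ r).ofLp ⬝ᵥ (X.metric s (γ r) *ᵥ (deriv γ r).ofLp))

/-- There is a `C¹` path `γ : [0,1] → s` of length `ℓ` from `x` to `y`, in some `n`-simplex `s`,
which runs in the open simplex except possibly at its endpoints. -/
def IsPiece (x y : X) (ℓ : ℝ≥0∞) : Prop :=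
  ∃ (s : X.complex.facets) (γ : ℝ → EuclideanSpace ℝ (Fin n)),
    ContDiff ℝ 1 γ ∧ (∀ r ∈ Ioo (0 : ℝ) 1, γ r ∈ openSimplex n) ∧
    X.chart s (γ 0) = x.1 ∧ X.chart s (γ 1) = y.1 ∧ ℓ = X.length s γ

/-- `x` and `y` are joined by a finite concatenation of pieces, of total length `ℓ`. -/
inductive IsPathLength (X : RiemannianPolyhedron E n) : X → X → ℝ≥0∞ → Prop
  | refl (x : X) : IsPathLength X x x 0
  | step {x y z : X} {a b : ℝ≥0∞} :
      IsPathLength X x y a → X.IsPiece y z b → IsPathLength X x z (a + b)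

/-- The intrinsic distance: the infimum of the lengths of the piecewise `C¹` paths. -/
noncomputable def distance (x y : X) : ℝ≥0∞ := sInf {ℓ | IsPathLength X x y ℓ}

variable {X}

theorem IsPathLength.trans {x y z : X} {a b : ℝ≥0∞} (h : IsPathLength X x y a)
    (h' : IsPathLength X y z b) : IsPathLength X x z (a + b) := by
  induction h' with
  | refl => simpa using h
  | step _ h2 ih => rw [← add_assoc]; exact ih.step h2

theorem IsPiece.symm {x y : X} {a : ℝ≥0∞} (h : X.IsPiece x y a) : X.IsPiece y x a := by
  obtain ⟨s, γ, hγ, hin, h0, h1, rfl⟩ := h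
  refine ⟨s, fun r => γ (1 - r), hγ.comp (contDiff_const.sub contDiff_id), ?_, by simpa using h1,
    by simpa using h0, ?_⟩
  · intro r hr
    exact hin _ ⟨by linarith [hr.2], by linarith [hr.1]⟩
  · have hmp : MeasurePreserving (fun r : ℝ => 1 - r) volume volume :=
      Measure.measurePreserving_sub_left volume 1
    have hemb : MeasurableEmbedding (fun r : ℝ => 1 - r) :=
      (MeasurableEquiv.subLeft (1 : ℝ)).measurableEmbedding
    have hpre : (fun r : ℝ => 1 - r) ⁻¹' Ioo 0 1 = Ioo 0 1 := by
      ext r; simp only [mem_preimage, mem_Ioo]; constructor <;> rintro ⟨_, _⟩ <;> constructor <;>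
        linarith
    unfold length
    rw [← hmp.setLIntegral_comp_preimage_emb hemb _ (Ioo 0 1), hpre]
    simp only [deriv_comp_const_sub, WithLp.ofLp_neg, Matrix.mulVec_neg, dotProduct_neg,
      neg_dotProduct, neg_neg]

theorem IsPathLength.symm {x y : X} {a : ℝ≥0∞} (h : IsPathLength X x y a) :
    IsPathLength X y x a := by
  induction h with
  | refl => exact .refl _
  | step _ h2 ih =>
    rw [add_comm]
    have := (IsPathLength.refl _).step h2.symm
    rw [zero_add] at this
    exact this.trans ih

/-- The polyhedron as a metric space. Its topology is the usual topology of a locally finite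
simplicial complex. -/
noncomputable instance : PseudoEMetricSpace X where
  edist := X.distance
  edist_self x := le_antisymm (sInf_le (.refl x)) zero_le
  edist_comm x y := by
    unfold distance
    congr 1
    ext ℓ
    exact ⟨.symm, .symm⟩
  edist_triangle x y z := by
    unfold distance
    rw [sInf_eq_iInf (s := {ℓ | IsPathLength X x y ℓ}),
      sInf_eq_iInf (s := {ℓ | IsPathLength X y z ℓ})]
    rw [ENNReal.iInf_add]
    refine le_iInf fun a => ?_
    rw [ENNReal.iInf_add]
    refine le_iInf fun ha => ?_
    rw [ENNReal.add_iInf]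
    refine le_iInf fun b => ?_
    rw [ENNReal.add_iInf]
    exact le_iInf fun hb => sInf_le (IsPathLength.trans ha hb)

noncomputable instance : MeasurableSpace X := borel X

instance : BorelSpace X := ⟨rfl⟩

variable (X)

/-- The skeleton of codimension two: the union of the simplices of dimension at most `n - 2`. -/
def skeletonCodimTwo : Set X :=
  {x | ∃ s ∈ X.complex.faces, s.card + 1 ≤ n ∧ x.1 ∈ convexHull ℝ (s : Set E)}

/-- Admissibility (dimensional homogeneity is built into the structure). -/
structure IsAdmissible : Prop where
  connected : ConnectedSpace X
  connected_compl : IsConnected (X.skeletonCodimTwo)ᶜ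

/-- The Riemannian volume density `(det g)^(1/2)` of the simplex `s` in coordinates. -/
noncomputable def density (s : X.complex.facets) (t : EuclideanSpace ℝ (Fin n)) : ℝ :=
  √(X.metric s t).det

/-- The Riemannian volume measure: the sum over all `n`-simplices of `(det g)^(1/2) dt`. -/
noncomputable def vol : Measure X :=
  Measure.sum fun s : X.complex.facets =>
    (((volume : Measure (EuclideanSpace ℝ (Fin n))).comap
      ((↑) : openSimplex n → EuclideanSpace ℝ (Fin n))).withDensity
        fun t => ENNReal.ofReal (X.density s t)).map
          fun t : openSimplex n => X.point s ⟨t.1, openSimplex_subset n t.2⟩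

open Classical in
/-- A function on the polyhedron in the coordinates of the simplex `s` (zero outside). -/
noncomputable def pull (s : X.complex.facets) (f : X → ℝ) (t : EuclideanSpace ℝ (Fin n)) : ℝ :=
  if h : t ∈ closedSimplex n then f (X.point s ⟨t, h⟩) else 0

/-- The vector of partial derivatives of a function on `ℝⁿ`. -/
noncomputable def partials (F : EuclideanSpace ℝ (Fin n) → ℝ) (t : EuclideanSpace ℝ (Fin n)) :
    Fin n → ℝ :=
  fun i => fderiv ℝ F t (EuclideanSpace.single i 1)

/-- `⟨∇φ, ∇f⟩ = ∑ g^{ij} ∂ᵢφ ∂ⱼf` at the point of the simplex `s` with coordinates `t`. -/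
noncomputable def gradInner (s : X.complex.facets) (φ f : X → ℝ)
    (t : EuclideanSpace ℝ (Fin n)) : ℝ :=
  partials (X.pull s φ) t ⬝ᵥ ((X.metric s t)⁻¹ *ᵥ partials (X.pull s f) t)

/-- `∫_X ⟨∇φ, ∇f⟩`, the sum of the integrals over the `n`-simplices. If `φ` has compact support,
only finitely many terms are non-zero; if `φ` and `f` are also locally Lipschitz, they are
differentiable almost everywhere in each simplex and each integrand is integrable. -/
noncomputable def dirichlet (φ f : X → ℝ) : ℝ :=
  ∑' s : X.complex.facets, ∫ t in openSimplex n, X.gradInner s φ f t * X.density s t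

/-- Weak subharmonicity of a (locally Lipschitz) function: `∫_X ⟨∇φ, ∇f⟩ ≤ 0` for all
non-negative Lipschitz test functions `φ` with compact support. -/
def IsWeaklySubharmonic (f : X → ℝ) : Prop :=
  ∀ φ : X → ℝ, LocallyLipschitz φ → HasCompactSupport φ → (∀ x, 0 ≤ φ x) → X.dirichlet φ f ≤ 0

end RiemannianPolyhedron

/-! The proof is Yau's: a Caccioppoli inequality with cutoffs tending to 1. Testing weak
subharmonicity with $\varphi=\rho^2\psi(f)$ gives $\int\rho^2\psi'(f)|\nabla
f|^2\le-2\int\rho\,\psi(f)\langle\nabla\rho,\nabla f\rangle$. Young's inequality absorbs half of the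
left side and leaves a multiple of $\int(\psi^2/\psi')(f)\,|\nabla\rho|^2$. The classical choice
$\psi(t)=t^{p-1}$ is not Lipschitz at 0 when $p<2$. It is replaced by `harmonicPower p`, which is
Lipschitz on $[0,\infty)$, strictly increasing, and still satisfies $\psi^2\le t^p\psi'/(p-1)$.
Hence $\int\rho^2\psi'(f)|\nabla f|^2\le\frac{4L^2}{p-1}\int f^p$ for every compactly supported
$L$-Lipschitz $\rho$ (`integral_energy_le_of_isWeaklySubharmonic`).

Completeness enters through Hopf–Rinow: closed balls are compact, so a $1/R$-Lipschitz cutoff equal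
to 1 on the ball of radius $R$ and vanishing off the ball of radius $2R$ is allowed. As
$R\to\infty$, $\nabla f=0$ almost everywhere on $\{f>0\}$; on $\{f=0\}$ the function has a minimum.
So $f$ is constant on each simplex (`LipschitzOnWith.eq_of_ae_fderiv_eq_zero`), hence along each
admissible path, and connectedness joins any two points by such a path.

Two points need care. The bound $|\nabla\rho|\le L$ must hold with the same $L$ in all simplices,
although the ellipticity constants vary from simplex to simplex; it comes from continuity of the
metric in the open simplex (`abs_fderiv_pull_le`). And the intrinsic topology must be locally
compact, with compact sets meeting finitely many simplices; this follows from the Lipschitz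
continuity of barycentric coordinates (`exists_lipschitzWith_bary`). -/

/-! ### Two general facts on length spaces and Lipschitz functions -/

/-- The Hopf–Rinow–Cohn-Vossen theorem: in a complete locally compact length space the closed balls
are compact. -/
theorem isCompact_closedEBall_of_length_space {Y : Type*} [PseudoEMetricSpace Y] [CompleteSpace Y]
    [LocallyCompactSpace Y]
    (hlen : ∀ (x y : Y) (a b : ℝ≥0∞), edist x y < a + b → ∃ z, edist x z ≤ a ∧ edist z y ≤ b)
    (x : Y) (r : ℝ) : IsCompact (Metric.closedEBall x (ENNReal.ofReal r)) := by
  set S : Set ℝ := {r | 0 ≤ r ∧ IsCompact (Metric.closedEBall x (ENNReal.ofReal r))} with hS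
  have hmono : ∀ a b : ℝ, a ≤ b → IsCompact (Metric.closedEBall x (ENNReal.ofReal b)) →
      IsCompact (Metric.closedEBall x (ENNReal.ofReal a)) := fun a b hab hb =>
    hb.of_isClosed_subset Metric.isClosed_closedEBall
      (Metric.closedEBall_subset_closedEBall (ENNReal.ofReal_le_ofReal hab))
  have h0 : (0 : ℝ) ∈ S := by
    refine ⟨le_rfl, ?_⟩
    have : Metric.closedEBall x (ENNReal.ofReal 0) = closure {x} := by
      ext y
      simp [Metric.mem_closure_iff_infEDist_zero]
    rw [this]
    exact isCompact_closure_singleton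
  by_cases hb : BddAbove S
  swap
  · rw [not_bddAbove_iff] at hb
    obtain ⟨b, hbS, hrb⟩ := hb r
    exact hmono r b hrb.le hbS.2
  exfalso
  set R := sSup S
  have hR0 : 0 ≤ R := le_csSup hb h0
  have hlt : ∀ a, 0 ≤ a → a < R → a ∈ S := by
    intro a ha haR
    obtain ⟨b, hbS, hab⟩ := exists_lt_of_lt_csSup ⟨0, h0⟩ haR
    exact ⟨ha, hmono a b hab.le hbS.2⟩
  -- By completeness only total boundedness is needed. Every point of the `R`-ball is within `2 * e`
  -- of the compact ball of radius `R - e`, and a finite `e`-net of the latter is a `3 * e`-net.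
  -- Using `2 * e` instead of `e` makes the inequality required by `hlen` strict.
  have hRc : IsCompact (Metric.closedEBall x (ENNReal.ofReal R)) := by
    rw [isCompact_iff_totallyBounded_isComplete]
    refine ⟨?_, Metric.isClosed_closedEBall.isComplete⟩
    rw [EMetric.totallyBounded_iff]
    intro ε hε
    obtain ⟨e, he0, heε⟩ : ∃ e : ℝ, 0 < e ∧ ENNReal.ofReal (3 * e) ≤ ε := by
      have h1 : min ε 1 ≠ ⊤ := ne_top_of_le_ne_top ENNReal.one_ne_top (min_le_right _ _)
      have h2 : 0 < (min ε 1).toReal := ENNReal.toReal_pos (by simp [hε.ne']) h1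
      refine ⟨(min ε 1).toReal / 3, by positivity, ?_⟩
      rw [mul_div_cancel₀ _ (by norm_num), ENNReal.ofReal_toReal h1]
      exact min_le_left _ _
    have hr' : max 0 (R - e) ∈ S := by
      rcases le_or_gt (R - e) 0 with h | h
      · rwa [max_eq_left h]
      · rw [max_eq_right h.le]
        exact hlt _ h.le (by linarith)
    obtain ⟨t, htf, ht⟩ := EMetric.totallyBounded_iff.1 hr'.2.totallyBounded (ENNReal.ofReal e)
      (by simpa using he0)
    refine ⟨t, htf, fun y hy => ?_⟩
    rw [Metric.mem_closedEBall, edist_comm] at hy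
    have hy' : edist x y < ENNReal.ofReal (max 0 (R - e)) + ENNReal.ofReal (2 * e) := by
      rw [← ENNReal.ofReal_add (le_max_left _ _) (by positivity)]
      refine hy.trans_lt ((ENNReal.ofReal_lt_ofReal_iff (by positivity)).2 ?_)
      linarith [le_max_right 0 (R - e)]
    obtain ⟨z, hz1, hz2⟩ := hlen x y _ _ hy'
    obtain ⟨w, hw, hzw⟩ := mem_iUnion₂.1 (ht (show z ∈ Metric.closedEBall x _ by
      rwa [Metric.mem_closedEBall, edist_comm]))
    refine mem_iUnion₂.2 ⟨w, hw, ?_⟩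
    rw [Metric.mem_eball] at hzw ⊢
    calc edist y w ≤ edist y z + edist z w := edist_triangle _ _ _
      _ < ENNReal.ofReal (2 * e) + ENNReal.ofReal e := by
        rw [edist_comm y z]
        exact ENNReal.add_lt_add_of_le_of_lt (ne_top_of_le_ne_top ENNReal.ofReal_ne_top hz2) hz2 hzw
      _ ≤ ε := by
        rw [← ENNReal.ofReal_add (by positivity) he0.le]
        convert heε using 2
        ring
  -- Local compactness gives a compact thickening of the `R`-ball. It contains the ball of radius `R
  -- + δ / 2`, against the choice of `R`.
  obtain ⟨δ, hδ, hδc⟩ := hRc.exists_isCompact_cthickening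
  have : R + δ / 2 ∈ S := by
    refine ⟨by positivity, hδc.of_isClosed_subset Metric.isClosed_closedEBall fun y hy => ?_⟩
    rw [Metric.mem_closedEBall, edist_comm] at hy
    obtain ⟨z, hz1, hz2⟩ := hlen x y (ENNReal.ofReal R) (ENNReal.ofReal δ) (by
      rw [← ENNReal.ofReal_add hR0 hδ.le]
      exact hy.trans_lt ((ENNReal.ofReal_lt_ofReal_iff (by positivity)).2 (by linarith)))
    rw [Metric.mem_cthickening_iff]
    refine (Metric.infEDist_le_edist_of_mem (y := z) ?_).trans ((edist_comm _ _).trans_le hz2)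
    rwa [Metric.mem_closedEBall, edist_comm]
  linarith [le_csSup hb this]

/-- A Lipschitz function on a convex open set whose derivative vanishes almost everywhere is
constant. -/
theorem LipschitzOnWith.eq_of_ae_fderiv_eq_zero {n : ℕ} {U : Set (EuclideanSpace ℝ (Fin n))}
    (hU : IsOpen U) (hconv : Convex ℝ U) {F : EuclideanSpace ℝ (Fin n) → ℝ} {K : ℝ≥0}
    (hF : LipschitzOnWith K F U) (h : ∀ᵐ t, t ∈ U → HasFDerivAt F (0 : _ →L[ℝ] ℝ) t)
    {x y : EuclideanSpace ℝ (Fin n)} (hx : x ∈ U) (hy : y ∈ U) : F x = F y := by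
  obtain ⟨N, hN, hNm, hN0⟩ := exists_measurable_superset_of_null h
  -- Fubini: the null set `N` need not be null on the segment from `x` to `y`, but it is on almost
  -- every parallel translate of it. For fixed `r` the condition only translates `N`.
  have hae : ∀ᵐ w : EuclideanSpace ℝ (Fin n), ∀ᵐ r : ℝ, x + w + r • (y - x) ∉ N := by
    rw [Measure.ae_ae_comm]
    · refine Filter.Eventually.of_forall fun r => ?_
      have hmp : MeasurePreserving (fun w : EuclideanSpace ℝ (Fin n) => w + (x + r • (y - x)))
          volume volume := measurePreserving_add_right volume _
      have := hmp.quasiMeasurePreserving.ae (p := fun z => z ∉ N)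
        (by rw [ae_iff]; simpa using hN0)
      filter_upwards [this] with w hw
      convert hw using 1
      abel_nf
    · have : Measurable fun q : EuclideanSpace ℝ (Fin n) × ℝ => x + q.1 + q.2 • (y - x) := by
        fun_prop
      exact (this hNm).compl
  have hdense := Measure.dense_of_ae hae
  have hgood : ∀ w, (∀ᵐ r : ℝ, x + w + r • (y - x) ∉ N) → x + w ∈ U → y + w ∈ U →
      F (x + w) = F (y + w) := by
    intro w hw hxw hyw
    have hseg : ∀ r ∈ Icc (0 : ℝ) 1, x + w + r • (y - x) ∈ U := by
      intro r hr
      have := hconv hxw hyw (sub_nonneg.2 hr.2) hr.1 (by ring)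
      convert this using 1
      module
    have hlip : LipschitzOnWith (K * ‖y - x‖₊) (fun r : ℝ => F (x + w + r • (y - x)))
        (uIcc 0 1) := by
      rw [uIcc_of_le zero_le_one]
      refine hF.comp (LipschitzWith.lipschitzOnWith ?_) hseg
      refine LipschitzWith.of_dist_le_mul fun a b => ?_
      rw [dist_add_left, dist_eq_norm, ← sub_smul, norm_smul, coe_nnnorm, mul_comm, Real.dist_eq,
        Real.norm_eq_abs]
    have := hlip.absolutelyContinuousOnInterval.const_of_ae_hasDerivAt_zero (by
      filter_upwards [hw] with r hr hr01
      rw [uIcc_of_le zero_le_one] at hr01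
      have hd : HasFDerivAt F (0 : _ →L[ℝ] ℝ) (x + w + r • (y - x)) := by
        by_contra hcon
        exact hr (hN (show ¬ (_ → _) from fun hc => hcon (hc (hseg r hr01))))
      have hl : HasDerivAt (fun r : ℝ => x + w + r • (y - x)) (y - x) r := by
        simpa using ((hasDerivAt_id r).smul_const (y - x)).const_add (x + w)
      have := hd.comp_hasDerivAt r hl
      rwa [_root_.zero_apply] at this)
    obtain ⟨c, hc⟩ := this
    have h0 := hc 0 (by simp)
    have h1 := hc 1 (by simp)
    simp only [zero_smul, add_zero, one_smul] at h0 h1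
    rw [h0, ← h1]
    congr 1
    abel
  -- Good translations `w` are dense, so `w` can be taken near 0 and continuity of `F` at `x` and
  -- `y` concludes.
  refine eq_of_forall_dist_le fun ε hε => ?_
  have hev : ∀ᶠ w in nhds (0 : EuclideanSpace ℝ (Fin n)),
      (x + w ∈ U ∧ y + w ∈ U) ∧ dist (F x) (F (x + w)) < ε / 2 ∧ dist (F (y + w)) (F y) < ε / 2 := by
    have tx : Filter.Tendsto (fun w => x + w) (nhds 0) (nhds x) := by
      have : Continuous fun w => x + w := by fun_prop
      simpa using this.tendsto 0
    have ty : Filter.Tendsto (fun w => y + w) (nhds 0) (nhds y) := by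
      have : Continuous fun w => y + w := by fun_prop
      simpa using this.tendsto 0
    have cx := (hF.continuousOn.continuousAt (hU.mem_nhds hx)).tendsto.comp tx
    have cy := (hF.continuousOn.continuousAt (hU.mem_nhds hy)).tendsto.comp ty
    filter_upwards [tx (hU.mem_nhds hx), ty (hU.mem_nhds hy),
      Metric.tendsto_nhds.1 cx (ε / 2) (by positivity),
      Metric.tendsto_nhds.1 cy (ε / 2) (by positivity)] with w h1 h2 h3 h4
    exact ⟨⟨h1, h2⟩, by rwa [dist_comm], h4⟩
  obtain ⟨w, hw1, hw2⟩ := hdense.inter_nhds_nonempty hev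
  have := hgood w hw1 hw2.1.1 hw2.1.2
  calc dist (F x) (F y) ≤ dist (F x) (F (x + w)) + dist (F (x + w)) (F y) := dist_triangle _ _ _
    _ ≤ ε / 2 + ε / 2 := by
      exact add_le_add hw2.2.1.le (this ▸ hw2.2.2.le)
    _ = ε := by ring

/-! ### The nonlinearity in the test function -/

/-- For `p > 1`, the function `t ↦ 1 / (t ^ (1 - p) + t⁻¹)` behaves like the smaller of `t` and
`t ^ (p - 1)`. -/
noncomputable def harmonicPower (p t : ℝ) : ℝ := (t ^ (1 - p) + t⁻¹)⁻¹

/-- The derivative of `harmonicPower p`. -/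
noncomputable def harmonicPowerDeriv (p t : ℝ) : ℝ :=
  ((p - 1) * t ^ (-p) + (t ^ 2)⁻¹) * harmonicPower p t ^ 2

section harmonicPower

variable {p : ℝ}

theorem harmonicPower_nonneg {t : ℝ} (ht : 0 ≤ t) : 0 ≤ harmonicPower p t := by
  unfold harmonicPower; positivity

theorem harmonicPower_pos {t : ℝ} (ht : 0 < t) : 0 < harmonicPower p t := by
  unfold harmonicPower; positivity

/-- The conventions `0 ^ (1 - p) = 0` and `0⁻¹ = 0` happen to give the limit value at 0. -/
theorem harmonicPower_zero (hp : 1 < p) : harmonicPower p 0 = 0 := by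
  have : (1 - p) ≠ 0 := by linarith
  simp [harmonicPower, Real.zero_rpow this]

theorem harmonicPower_le (hp : 1 < p) {t : ℝ} (ht : 0 ≤ t) : harmonicPower p t ≤ t := by
  rcases ht.eq_or_lt with rfl | ht
  · exact (harmonicPower_zero hp).le
  · have h : 0 < t⁻¹ := by positivity
    have h' : 0 ≤ t ^ (1 - p) := by positivity
    calc harmonicPower p t ≤ (t⁻¹)⁻¹ := inv_anti₀ h (by linarith)
      _ = t := inv_inv t

theorem hasDerivAt_harmonicPower {t : ℝ} (ht : 0 < t) :
    HasDerivAt (harmonicPower p) (harmonicPowerDeriv p t) t := by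
  have h : 0 < t ^ (1 - p) + t⁻¹ := by positivity
  have h1 : HasDerivAt (harmonicPower p) _ t := ((Real.hasDerivAt_rpow_const (p := 1 - p)
    (Or.inl ht.ne')).fun_add (hasDerivAt_inv ht.ne')).fun_inv h.ne'
  refine h1.congr_deriv ?_
  rw [harmonicPowerDeriv, harmonicPower, show 1 - p - 1 = -p by ring]
  field_simp
  ring

theorem harmonicPowerDeriv_nonneg (hp : 1 < p) {t : ℝ} (ht : 0 ≤ t) :
    0 ≤ harmonicPowerDeriv p t := by
  have : 0 < p - 1 := by linarith
  unfold harmonicPowerDeriv; positivity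

theorem harmonicPowerDeriv_pos (hp : 1 < p) {t : ℝ} (ht : 0 < t) :
    0 < harmonicPowerDeriv p t := by
  have : 0 < p - 1 := by linarith
  have := harmonicPower_pos (p := p) ht
  unfold harmonicPowerDeriv; positivity

/-- With $a=t^{1-p}$ and $b=t^{-1}$ one has $t^{-p}=ab$, so the derivative is
$((p-1)ab+b^2)/(a+b)^2$. -/
theorem harmonicPowerDeriv_le (hp : 1 < p) {t : ℝ} (ht : 0 < t) : harmonicPowerDeriv p t ≤ p := by
  have h : 0 < t ^ (1 - p) + t⁻¹ := by positivity
  have h1 : 0 < t ^ (1 - p) := by positivity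
  have h2 : 0 < t⁻¹ := by positivity
  have h3 : t ^ (-p) = t ^ (1 - p) * t⁻¹ := by
    rw [← Real.rpow_neg_one t, ← Real.rpow_add ht]; congr 1; ring
  rw [harmonicPowerDeriv, harmonicPower, h3, inv_pow, ← div_eq_mul_inv, div_le_iff₀ (by positivity),
    ← inv_pow]
  nlinarith [mul_pos h1 h2, mul_pos h1 h1, mul_pos h2 h2]

/-- This is the inequality that turns $\psi^2/\psi'$ into the integrable $f^p$. The derivative is
$((p-1)t^{-p}+t^{-2})\psi^2$, and its first summand alone suffices. -/
theorem harmonicPower_sq_le (hp : 1 < p) {t : ℝ} (ht : 0 < t) :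
    harmonicPower p t ^ 2 ≤ t ^ p / (p - 1) * harmonicPowerDeriv p t := by
  have h0 : 0 < p - 1 := by linarith
  have h3 : t ^ p * t ^ (-p) = 1 := by rw [← Real.rpow_add ht]; simp
  have h4 : 0 < t ^ p := by positivity
  rw [harmonicPowerDeriv, ← mul_assoc]
  refine le_mul_of_one_le_left (sq_nonneg _) ?_
  calc (1 : ℝ) = t ^ p / (p - 1) * ((p - 1) * t ^ (-p)) := by
        rw [div_mul_eq_mul_div, eq_div_iff h0.ne']
        linear_combination (1 - p) * h3
    _ ≤ _ := by gcongr; simp; positivity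

theorem lipschitzOnWith_harmonicPower (hp : 1 < p) :
    LipschitzOnWith p.toNNReal (harmonicPower p) (Ici 0) := by
  have hcont : ContinuousOn (harmonicPower p) (Ici 0) := by
    intro t ht
    rcases (mem_Ici.1 ht).eq_or_lt with rfl | ht
    · have : Filter.Tendsto (harmonicPower p) (nhdsWithin 0 (Ici 0)) (nhds 0) := by
        refine tendsto_of_tendsto_of_tendsto_of_le_of_le' tendsto_const_nhds
          (Filter.tendsto_id.mono_left nhdsWithin_le_nhds)
          (eventually_mem_nhdsWithin.mono fun t ht => harmonicPower_nonneg ht)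
          (eventually_mem_nhdsWithin.mono fun t ht => harmonicPower_le hp ht)
      rwa [ContinuousWithinAt, harmonicPower_zero hp]
    · exact (hasDerivAt_harmonicPower ht).continuousAt.continuousWithinAt
  have hdiff : DifferentiableOn ℝ (harmonicPower p) (interior (Ici 0)) := by
    rw [interior_Ici]
    exact fun t ht => (hasDerivAt_harmonicPower ht).differentiableAt.differentiableWithinAt
  have hmono : MonotoneOn (harmonicPower p) (Ici 0) :=
    monotoneOn_of_deriv_nonneg (convex_Ici 0) hcont hdiff fun t ht => by
      rw [interior_Ici] at ht
      rw [(hasDerivAt_harmonicPower ht).deriv]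
      exact harmonicPowerDeriv_nonneg hp ht.le
  have hle := (convex_Ici (0 : ℝ)).image_sub_le_mul_sub_of_deriv_le hcont hdiff (C := p)
    fun t ht => by
      rw [interior_Ici] at ht
      rw [(hasDerivAt_harmonicPower ht).deriv]
      exact harmonicPowerDeriv_le hp ht
  refine LipschitzOnWith.of_le_add_mul _ fun x hx y hy => ?_
  rw [Real.coe_toNNReal _ (by linarith)]
  rcases le_total x y with h | h
  · have := hmono hx hy h
    have : 0 ≤ p * dist x y := by positivity
    linarith
  · have := hle y hy x hx h
    rw [Real.dist_eq, abs_of_nonneg (by linarith)]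
    linarith

theorem measurable_harmonicPowerDeriv : Measurable (harmonicPowerDeriv p) := by
  unfold harmonicPowerDeriv harmonicPower
  fun_prop

end harmonicPower

/-! ### The coordinate simplex -/

section simplex

variable {n : ℕ}

theorem isOpen_openSimplex (n : ℕ) : IsOpen (openSimplex n) := by
  have : openSimplex n = (⋂ i, {t | 0 < t i}) ∩ {t | ∑ i, t i < 1} := by
    ext t; simp [openSimplex]
  rw [this]
  exact (isOpen_iInter_of_finite fun i => isOpen_lt (by fun_prop) (by fun_prop)).inter
    (isOpen_lt (by fun_prop) (by fun_prop))

theorem isClosed_closedSimplex (n : ℕ) : IsClosed (closedSimplex n) := by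
  have : closedSimplex n = (⋂ i, {t | 0 ≤ t i}) ∩ {t | ∑ i, t i ≤ 1} := by
    ext t; simp [closedSimplex]
  rw [this]
  exact (isClosed_iInter fun i => isClosed_le (by fun_prop) (by fun_prop)).inter
    (isClosed_le (by fun_prop) (by fun_prop))

theorem isCompact_closedSimplex (n : ℕ) : IsCompact (closedSimplex n) := by
  refine Metric.isCompact_of_isClosed_isBounded (isClosed_closedSimplex n) ?_
  refine (Metric.isBounded_closedBall (x := 0) (r := 1)).subset fun t ht => ?_
  rw [mem_closedBall_zero_iff, EuclideanSpace.norm_eq, Real.sqrt_le_one]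
  calc ∑ i, ‖t i‖ ^ 2 ≤ ∑ i, t i := Finset.sum_le_sum fun i _ => by
        have h1 : t i ≤ 1 :=
          (Finset.single_le_sum (fun j _ => ht.1 j) (Finset.mem_univ i)).trans ht.2
        rw [Real.norm_eq_abs, sq_abs]
        nlinarith [ht.1 i]
    _ ≤ 1 := ht.2

theorem segment_mem_openSimplex {x y : EuclideanSpace ℝ (Fin n)} (hx : x ∈ openSimplex n)
    (hy : y ∈ closedSimplex n) {r : ℝ} (h0 : 0 ≤ r) (h1 : r < 1) :
    x + r • (y - x) ∈ openSimplex n := by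
  refine ⟨fun i => ?_, ?_⟩
  · have := hx.1 i
    have := hy.1 i
    simp only [PiLp.add_apply, PiLp.smul_apply, PiLp.sub_apply, smul_eq_mul]
    nlinarith
  · have := hx.2
    have := hy.2
    simp only [PiLp.add_apply, PiLp.smul_apply, PiLp.sub_apply, smul_eq_mul,
      Finset.sum_add_distrib, ← Finset.mul_sum, Finset.sum_sub_distrib]
    nlinarith

theorem convex_openSimplex (n : ℕ) : Convex ℝ (openSimplex n) := by
  rw [convex_iff_add_mem]
  intro x hx y hy a b ha hb hab
  rcases ha.eq_or_lt with rfl | ha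
  · obtain rfl : b = 1 := by linarith
    simpa using hy
  · convert segment_mem_openSimplex hx (openSimplex_subset n hy) hb (by linarith : b < 1) using 1
    obtain rfl : a = 1 - b := by linarith
    module

theorem openSimplex_nonempty (n : ℕ) : (openSimplex n).Nonempty := by
  refine ⟨WithLp.toLp 2 fun _ => 1 / ((n : ℝ) + 1), fun i => ?_, ?_⟩
  · show (0 : ℝ) < 1 / ((n : ℝ) + 1)
    positivity
  · show ∑ _i : Fin n, 1 / ((n : ℝ) + 1) < 1
    rw [Finset.sum_const, Finset.card_univ, Fintype.card_fin, nsmul_eq_mul, mul_one_div,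
      div_lt_one (by positivity)]
    linarith

theorem closedSimplex_subset_closure (n : ℕ) : closedSimplex n ⊆ closure (openSimplex n) := by
  intro y hy
  obtain ⟨x, hx⟩ := openSimplex_nonempty n
  have hc : Continuous fun r : ℝ => x + r • (y - x) := by fun_prop
  have h1 : (1 : ℝ) ∈ closure (Ico (0 : ℝ) 1) := by
    rw [closure_Ico zero_ne_one]; simp
  have := map_mem_closure hc h1 (t := openSimplex n)
    fun r hr => segment_mem_openSimplex hx hy hr.1 hr.2
  simpa using this

end simplex

/-! ### Riemannian norms, lengths and the intrinsic distance -/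

namespace RiemannianPolyhedron

variable {E : Type*} [AddCommGroup E] [Module ℝ E] {n : ℕ} (X : RiemannianPolyhedron E n)

theorem metric_posDef (s : X.complex.facets) {t : EuclideanSpace ℝ (Fin n)}
    (ht : t ∈ openSimplex n) : (X.metric s t).PosDef := by
  refine Matrix.PosDef.of_dotProduct_mulVec_pos ?_ fun {v} hv => ?_
  · rw [Matrix.IsHermitian, Matrix.conjTranspose_eq_transpose_of_trivial]
    exact X.metric_symm s t ht
  · obtain ⟨c, hc, C, h⟩ := X.metric_elliptic s
    rw [star_trivial]
    refine lt_of_lt_of_le (mul_pos hc ?_) (h t ht v).1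
    simpa using Matrix.dotProduct_star_self_pos_iff.2 hv

/-- The Riemannian norm of the tangent vector `v` at the point of `s` with coordinates `t`. -/
noncomputable def tangentNorm (s : X.complex.facets) (t v : EuclideanSpace ℝ (Fin n)) : ℝ :=
  √(v.ofLp ⬝ᵥ (X.metric s t *ᵥ v.ofLp))

theorem length_eq (s : X.complex.facets) (γ : ℝ → EuclideanSpace ℝ (Fin n)) :
    X.length s γ = ∫⁻ r in Ioo (0 : ℝ) 1, ENNReal.ofReal (X.tangentNorm s (γ r) (deriv γ r)) := rfl

theorem tangentNorm_smul (s : X.complex.facets) (t v : EuclideanSpace ℝ (Fin n)) (a : ℝ) :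
    X.tangentNorm s t (a • v) = |a| * X.tangentNorm s t v := by
  rw [tangentNorm, tangentNorm, WithLp.ofLp_smul, Matrix.mulVec_smul, dotProduct_smul,
    smul_dotProduct, smul_smul, smul_eq_mul, Real.sqrt_mul (mul_self_nonneg a),
    Real.sqrt_mul_self_eq_abs]

theorem dotProduct_self_eq (v : EuclideanSpace ℝ (Fin n)) : v.ofLp ⬝ᵥ v.ofLp = ‖v‖ ^ 2 := by
  rw [EuclideanSpace.norm_sq_eq]
  simp [dotProduct, sq]

theorem exists_tangentNorm_le (s : X.complex.facets) : ∃ C : ℝ≥0, ∀ t ∈ openSimplex n, ∀ v,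
    X.tangentNorm s t v ≤ C * ‖v‖ := by
  obtain ⟨c, hc, C, h⟩ := X.metric_elliptic s
  refine ⟨(√C).toNNReal, fun t ht v => ?_⟩
  rw [Real.coe_toNNReal _ (Real.sqrt_nonneg _), tangentNorm]
  calc _ ≤ √(C * ‖v‖ ^ 2) := Real.sqrt_le_sqrt (by
        rw [← dotProduct_self_eq]; exact (h t ht v.ofLp).2)
    _ = √C * ‖v‖ := by rw [Real.sqrt_mul' _ (sq_nonneg _), Real.sqrt_sq (norm_nonneg _)]

theorem exists_norm_le (s : X.complex.facets) : ∃ C : ℝ≥0, ∀ t ∈ openSimplex n, ∀ v,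
    ‖v‖ ≤ C * X.tangentNorm s t v := by
  obtain ⟨c, hc, C, h⟩ := X.metric_elliptic s
  refine ⟨(√c)⁻¹.toNNReal, fun t ht v => ?_⟩
  have hc' := Real.sqrt_pos.2 hc
  rw [Real.coe_toNNReal _ (by positivity), inv_mul_eq_div, le_div_iff₀ hc', mul_comm, tangentNorm]
  calc √c * ‖v‖ = √(c * ‖v‖ ^ 2) := by
        rw [Real.sqrt_mul' _ (sq_nonneg _), Real.sqrt_sq (norm_nonneg _)]
    _ ≤ _ := Real.sqrt_le_sqrt (by
        rw [← dotProduct_self_eq]; exact (h t ht v.ofLp).1)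

theorem continuousOn_tangentNorm (s : X.complex.facets) {A : Type*} [TopologicalSpace A]
    {a v : A → EuclideanSpace ℝ (Fin n)} {S : Set A} (ha : ContinuousOn a S)
    (hv : ContinuousOn v S) (h : MapsTo a S (openSimplex n)) :
    ContinuousOn (fun r => X.tangentNorm s (a r) (v r)) S := by
  have h1 : ContinuousOn (fun r => X.metric s (a r)) S := (X.metric_continuous s).comp ha h
  have h2 : ContinuousOn (fun r => (v r).ofLp) S :=
    (PiLp.continuous_ofLp 2 _).comp_continuousOn hv
  rw [continuousOn_iff_continuous_domRestrict] at h1 h2 ⊢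
  exact (h2.dotProduct (h1.matrix_mulVec h2)).sqrt

variable {X}

theorem IsPiece.edist_le {x y : X} {ℓ : ℝ≥0∞} (h : X.IsPiece x y ℓ) : edist x y ≤ ℓ := by
  have := (IsPathLength.refl x).step h
  rw [zero_add] at this
  exact sInf_le this

theorem edist_le_of_isPathLength {x y : X} {ℓ : ℝ≥0∞} (h : IsPathLength X x y ℓ) :
    edist x y ≤ ℓ := sInf_le h

theorem exists_isPathLength_of_edist_lt {x y : X} {a : ℝ≥0∞} (h : edist x y < a) :
    ∃ ℓ < a, IsPathLength X x y ℓ := by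
  obtain ⟨ℓ, h1, h2⟩ := sInf_lt_iff.1 (show sInf {ℓ | IsPathLength X x y ℓ} < a from h)
  exact ⟨ℓ, h2, h1⟩

/-- The intrinsic distance of two points of a path is at most the length of the path between
them. -/
theorem edist_point_le_lintegral (s : X.complex.facets) {γ : ℝ → EuclideanSpace ℝ (Fin n)}
    (hγ : ContDiff ℝ 1 γ) {a b : ℝ} (hab : a ≤ b) (hin : ∀ r ∈ Ioo a b, γ r ∈ openSimplex n)
    (ha : γ a ∈ closedSimplex n) (hb : γ b ∈ closedSimplex n) :
    edist (X.point s ⟨γ a, ha⟩) (X.point s ⟨γ b, hb⟩) ≤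
      ∫⁻ r in Ioo a b, ENNReal.ofReal (X.tangentNorm s (γ r) (deriv γ r)) := by
  rcases hab.eq_or_lt with rfl | hab
  · simp
  have hba : 0 < b - a := sub_pos.2 hab
  have himg : (fun r : ℝ => (b - a) * r + a) '' Ioo 0 1 = Ioo a b := by
    rw [image_affine_Ioo hba]
    simp
  have hder : ∀ r : ℝ, HasDerivAt (fun r : ℝ => (b - a) * r + a) (b - a) r := fun r => by
    simpa using ((hasDerivAt_id r).const_mul (b - a)).add_const a
  have hmaps : ∀ r ∈ Ioo (0 : ℝ) 1, (b - a) * r + a ∈ Ioo a b := fun r hr => by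
    rw [← himg]; exact mem_image_of_mem _ hr
  refine (IsPiece.edist_le ⟨s, fun r => γ ((b - a) * r + a), ?_, fun r hr => hin _ (hmaps r hr),
    by simp [point], by simp [point], rfl⟩).trans_eq ?_
  · exact hγ.comp ((contDiff_const.mul contDiff_id).add contDiff_const)
  · rw [← himg, lintegral_image_eq_lintegral_abs_deriv_mul measurableSet_Ioo
      (fun r _ => (hder r).hasDerivWithinAt)
      (fun r _ r' _ h => by simpa [hba.ne'] using h), length_eq]
    refine setLIntegral_congr_fun measurableSet_Ioo fun r _ => ?_
    have : deriv (fun r => γ ((b - a) * r + a)) r = (b - a) • deriv γ ((b - a) * r + a) :=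
      ((hγ.differentiable one_ne_zero _).hasDerivAt.scomp r (hder r)).deriv
    simp only [this, tangentNorm_smul]
    rw [ENNReal.ofReal_mul (abs_nonneg _)]

/-- A straight segment is an admissible path, so a bound on its speed bounds the distance. It serves
both for the global Lipschitz estimate of the chart and for the sharp infinitesimal one. -/
theorem edist_point_le_of_segment (s : X.complex.facets) {x y : EuclideanSpace ℝ (Fin n)}
    (hx : x ∈ closedSimplex n) (hy : y ∈ closedSimplex n)
    (hin : ∀ r ∈ Ioo (0 : ℝ) 1, x + r • (y - x) ∈ openSimplex n) {B : ℝ}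
    (hB : ∀ r ∈ Ioo (0 : ℝ) 1, X.tangentNorm s (x + r • (y - x)) (y - x) ≤ B) :
    edist (X.point s ⟨x, hx⟩) (X.point s ⟨y, hy⟩) ≤ ENNReal.ofReal B := by
  have hγ : ContDiff ℝ 1 fun r : ℝ => x + r • (y - x) :=
    contDiff_const.add (contDiff_id.smul contDiff_const)
  have hd : ∀ r : ℝ, deriv (fun r : ℝ => x + r • (y - x)) r = y - x := fun r => by
    simpa using (((hasDerivAt_id r).smul_const (y - x)).const_add x).deriv
  have := edist_point_le_lintegral s hγ zero_le_one hin (by simpa using hx) (by simpa using hy)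
  simp only [zero_smul, add_zero, one_smul, add_sub_cancel, hd] at this
  refine this.trans ((setLIntegral_mono measurable_const fun r hr =>
    ENNReal.ofReal_le_ofReal (hB r hr)).trans ?_)
  simp

theorem exists_lipschitzWith_point (s : X.complex.facets) :
    ∃ C : ℝ≥0, LipschitzWith C (X.point s) := by
  obtain ⟨C, hC⟩ := X.exists_tangentNorm_le s
  refine ⟨C, ?_⟩
  have key : ∀ x y : closedSimplex n, x.1 ∈ openSimplex n →
      edist (X.point s x) (X.point s y) ≤ C * edist x y := by
    intro x y hx
    have hin : ∀ r ∈ Ioo (0 : ℝ) 1, x.1 + r • (y.1 - x.1) ∈ openSimplex n := fun r hr =>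
      segment_mem_openSimplex hx y.2 hr.1.le hr.2
    refine (edist_point_le_of_segment s x.2 y.2 hin fun r hr => hC _ (hin r hr) _).trans_eq ?_
    rw [ENNReal.ofReal_mul C.coe_nonneg, ENNReal.ofReal_coe_nnreal, edist_comm x y, Subtype.edist_eq,
      edist_eq_enorm_sub, ofReal_norm]
  intro x y
  -- Two boundary points may span a segment inside the boundary, which is not admissible. The path
  -- goes through an interior point `z` instead, and `z` tends to `x`.
  have hcl : Filter.Tendsto (fun z : EuclideanSpace ℝ (Fin n) => C * edist z x.1 + C * edist z y.1)
      (nhds x.1) (nhds (C * edist x.1 x.1 + C * edist x.1 y.1)) := by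
    refine Filter.Tendsto.add ?_ ?_ <;>
      exact ENNReal.Tendsto.const_mul (Filter.tendsto_id.edist tendsto_const_nhds)
        (Or.inr ENNReal.coe_ne_top)
  rw [edist_self, mul_zero, zero_add] at hcl
  have := mem_closure_iff_nhdsWithin_neBot.1 (closedSimplex_subset_closure n x.2)
  refine ge_of_tendsto (x := nhdsWithin x.1 (openSimplex n)) (hcl.mono_left nhdsWithin_le_nhds)
    (eventually_mem_nhdsWithin.mono fun z hz => ?_)
  have h1 := key ⟨z, openSimplex_subset n hz⟩ x hz
  have h2 := key ⟨z, openSimplex_subset n hz⟩ y hz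
  refine (edist_triangle_left _ _ _).trans (add_le_add h1 h2)

/-- A path which runs in the open simplex stays in the closed simplex. -/
theorem mem_closedSimplex_of_path {γ : ℝ → EuclideanSpace ℝ (Fin n)} (hγ : Continuous γ)
    (hin : ∀ r ∈ Ioo (0 : ℝ) 1, γ r ∈ openSimplex n) {r : ℝ} (hr : r ∈ Icc (0 : ℝ) 1) :
    γ r ∈ closedSimplex n := by
  rw [← closure_Ioo zero_ne_one] at hr
  have := map_mem_closure hγ hr (t := openSimplex n) hin
  exact closure_minimal (openSimplex_subset n) (isClosed_closedSimplex n) this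

theorem integrableOn_tangentNorm (s : X.complex.facets) {γ : ℝ → EuclideanSpace ℝ (Fin n)}
    (hγ : ContDiff ℝ 1 γ) (hin : ∀ r ∈ Ioo (0 : ℝ) 1, γ r ∈ openSimplex n) :
    IntegrableOn (fun r => X.tangentNorm s (γ r) (deriv γ r)) (Ioo 0 1) := by
  have hd : Continuous (deriv γ) := hγ.continuous_deriv le_rfl
  obtain ⟨C, hC⟩ := X.exists_tangentNorm_le s
  obtain ⟨M, hM⟩ := isCompact_Icc.exists_bound_of_continuousOn (hd.continuousOn (s := Icc (0:ℝ) 1))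
  refine Integrable.of_bound (C := C * M) ?_ ?_
  · exact (X.continuousOn_tangentNorm s hγ.continuous.continuousOn hd.continuousOn
      hin).aestronglyMeasurable measurableSet_Ioo
  · refine (ae_restrict_iff' measurableSet_Ioo).2 (Filter.Eventually.of_forall fun r hr => ?_)
    rw [tangentNorm, Real.norm_eq_abs, abs_of_nonneg (Real.sqrt_nonneg _)]
    exact (hC _ (hin r hr) _).trans
      (mul_le_mul_of_nonneg_left (hM r (Ioo_subset_Icc_self hr)) C.coe_nonneg)

/-- A path in a simplex can be cut at every length. -/
theorem IsPiece.exists_between {x y : X} {ℓ a b : ℝ≥0∞} (h : X.IsPiece x y ℓ) (hab : ℓ ≤ a + b) :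
    ∃ z, edist x z ≤ a ∧ edist z y ≤ b := by
  rcases le_or_gt ℓ a with hla | hal
  · exact ⟨y, h.edist_le.trans hla, by simp⟩
  obtain ⟨s, γ, hγ, hin, h0, h1, rfl⟩ := h
  have haT : a ≠ ⊤ := (hal.trans_le le_top).ne
  have hmem : ∀ {r}, r ∈ Icc (0 : ℝ) 1 → γ r ∈ closedSimplex n :=
    fun hr => mem_closedSimplex_of_path hγ.continuous hin hr
  set v : ℝ → ℝ := fun r => X.tangentNorm s (γ r) (deriv γ r) with hv
  -- The speed is cut off outside `Ioo 0 1`, where neither the path nor the metric is controlled;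
  -- the primitive is then continuous on the whole line and the intermediate value theorem finds the
  -- cutting time.
  have hint : Integrable ((Ioo (0 : ℝ) 1).indicator v) :=
    (integrableOn_tangentNorm s hγ hin).integrable_indicator measurableSet_Ioo
  have hcont := intervalIntegral.continuous_primitive
    (fun _ _ => hint.intervalIntegrable) 0
  have hF : ∀ c d : ℝ, c ≤ d → Ioo c d ⊆ Ioo 0 1 → ∫⁻ r in Ioo c d, ENNReal.ofReal (v r) =
      ENNReal.ofReal (∫ r in c..d, (Ioo (0 : ℝ) 1).indicator v r) := by
    intro c d hcd hsub
    rw [intervalIntegral.integral_of_le hcd, integral_Ioc_eq_integral_Ioo,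
      setIntegral_congr_fun measurableSet_Ioo (g := v) fun r hr => by simp [hsub hr],
      ofReal_integral_eq_lintegral_ofReal ((integrableOn_tangentNorm s hγ hin).mono_set hsub)]
    exact Filter.Eventually.of_forall fun r => Real.sqrt_nonneg _
  have hlen : X.length s γ =
      ENNReal.ofReal (∫ r in (0 : ℝ)..1, (Ioo (0 : ℝ) 1).indicator v r) := by
    rw [length_eq, hF 0 1 zero_le_one le_rfl]
  have hnn : ∀ r, 0 ≤ (Ioo (0 : ℝ) 1).indicator v r :=
    fun r => indicator_nonneg (fun _ _ => Real.sqrt_nonneg _) r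
  obtain ⟨τ, hτ, hτa⟩ := intermediate_value_Icc (zero_le_one (α := ℝ)) hcont.continuousOn
    (show a.toReal ∈ _ from ⟨by simp, by
      rw [← ENNReal.ofReal_le_ofReal_iff (intervalIntegral.integral_nonneg zero_le_one
        fun r _ => hnn r), ENNReal.ofReal_toReal haT, ← hlen]
      exact hal.le⟩)
  beta_reduce at hτa
  have hx : x = X.point s ⟨γ 0, hmem (by simp)⟩ := Subtype.ext h0.symm
  have hy : y = X.point s ⟨γ 1, hmem (by simp)⟩ := Subtype.ext h1.symm
  have e1 : ∫⁻ r in Ioo 0 τ, ENNReal.ofReal (v r) = a := by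
    rw [hF 0 τ hτ.1 (Ioo_subset_Ioo_right hτ.2), hτa, ENNReal.ofReal_toReal haT]
  have e2 : a + ∫⁻ r in Ioo τ 1, ENNReal.ofReal (v r) = X.length s γ := by
    rw [hF τ 1 hτ.2 (Ioo_subset_Ioo_left hτ.1), hlen, ← ENNReal.ofReal_toReal haT, ← hτa,
      ← ENNReal.ofReal_add, intervalIntegral.integral_add_adjacent_intervals
        hint.intervalIntegrable hint.intervalIntegrable]
    · exact intervalIntegral.integral_nonneg hτ.1 fun r _ => hnn r
    · exact intervalIntegral.integral_nonneg hτ.2 fun r _ => hnn r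
  refine ⟨X.point s ⟨γ τ, hmem hτ⟩, ?_, ?_⟩
  · rw [hx, ← e1]
    exact edist_point_le_lintegral s hγ hτ.1
      (fun r hr => hin r (Ioo_subset_Ioo_right hτ.2 hr)) _ _
  · rw [hy]
    refine (edist_point_le_lintegral s hγ hτ.2
      (fun r hr => hin r (Ioo_subset_Ioo_left hτ.1 hr)) _ _).trans ?_
    rw [← e2] at hab
    exact (ENNReal.add_le_add_iff_left haT).1 hab

/-- The cut falls in the last piece when the preceding ones have total length at most `a`, and
otherwise in the preceding ones, by induction. -/
theorem IsPathLength.exists_between {x y : X} {ℓ : ℝ≥0∞} (h : IsPathLength X x y ℓ) :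
    ∀ {a b : ℝ≥0∞}, ℓ ≤ a + b → ∃ z, edist x z ≤ a ∧ edist z y ≤ b := by
  induction h with
  | refl => exact fun _ => ⟨x, by simp, by simp⟩
  | @step y z a₁ b₁ h₁ h₂ ih =>
    intro a b hab
    by_cases ha : a = ⊤
    · exact ⟨z, by simp [ha], by simp⟩
    rcases le_total a₁ a with h | h
    · obtain ⟨w, hw1, hw2⟩ := h₂.exists_between (a := a - a₁) (b := b) (by
        rwa [← ENNReal.add_le_add_iff_left (ne_top_of_le_ne_top ha h), ← add_assoc,
          add_tsub_cancel_of_le h])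
      refine ⟨w, (edist_triangle _ y _).trans ?_, hw2⟩
      calc _ ≤ a₁ + (a - a₁) := add_le_add (edist_le_of_isPathLength h₁) hw1
        _ = a := add_tsub_cancel_of_le h
    · obtain ⟨w, hw1, hw2⟩ := ih (a := a) (b := a₁ - a) (add_tsub_cancel_of_le h).ge
      refine ⟨w, hw1, (edist_triangle _ y _).trans ((add_le_add hw2 h₂.edist_le).trans ?_)⟩
      rw [← ENNReal.add_le_add_iff_left ha, ← add_assoc, add_tsub_cancel_of_le h]
      exact hab

/-- This is the length-space hypothesis of the Hopf–Rinow theorem. -/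
theorem exists_between_of_edist_lt (x y : X) (a b : ℝ≥0∞) (h : edist x y < a + b) :
    ∃ z, edist x z ≤ a ∧ edist z y ≤ b := by
  obtain ⟨ℓ, hℓ, hp⟩ := exists_isPathLength_of_edist_lt h
  exact hp.exists_between hℓ.le

/-! ### Barycentric coordinates and the topology of the polyhedron -/

/-- The coordinates of a point of a simplex with affinely independent vertices are unique. -/
theorem _root_.AffineIndependent.weights_eq {s : Finset E}
    (hs : AffineIndependent ℝ ((↑) : s → E)) {w w' : E → ℝ} (h : ∑ v ∈ s, w v = ∑ v ∈ s, w' v)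
    (h' : ∑ v ∈ s, w v • v = ∑ v ∈ s, w' v • v) {v : E} (hv : v ∈ s) : w v = w' v := by
  have := hs.eq_zero_of_sum_eq_zero (s := Finset.univ) (w := fun v : s => w v - w' v)
    (by rw [Finset.sum_coe_sort s (fun v => w v - w' v), Finset.sum_sub_distrib, h, sub_self])
    (by
      rw [Finset.sum_coe_sort s (fun v => (w v - w' v) • v)]
      simp only [sub_smul, Finset.sum_sub_distrib, h', sub_self]) ⟨v, hv⟩ (Finset.mem_univ _)
  exact sub_eq_zero.1 this

/-- `w` is a system of barycentric coordinates of the point `y` of the face `s`. -/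
structure IsBarycentric (s : Finset E) (y : E) (w : E → ℝ) : Prop where
  nonneg : ∀ v, 0 ≤ w v
  eq_zero : ∀ v ∉ s, w v = 0
  sum_eq_one : ∑ v ∈ s, w v = 1
  sum_smul_eq : ∑ v ∈ s, w v • v = y

theorem IsBarycentric.mono {s t : Finset E} {y : E} {w : E → ℝ} (h : IsBarycentric s y w)
    (hst : s ⊆ t) : IsBarycentric t y w where
  nonneg := h.nonneg
  eq_zero v hv := h.eq_zero v fun hs => hv (hst hs)
  sum_eq_one := by
    rw [← h.sum_eq_one]
    exact (Finset.sum_subset hst fun v _ hv => h.eq_zero v hv).symm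
  sum_smul_eq := by
    rw [← h.sum_smul_eq]
    exact (Finset.sum_subset hst fun v _ hv => by rw [h.eq_zero v hv, zero_smul]).symm

theorem IsBarycentric.mem_convexHull {s : Finset E} {y : E} {w : E → ℝ}
    (h : IsBarycentric s y w) : y ∈ convexHull ℝ (s : Set E) :=
  Finset.mem_convexHull'.2 ⟨w, fun v _ => h.nonneg v, h.sum_eq_one, h.sum_smul_eq⟩

theorem exists_isBarycentric {s : Finset E} {y : E} (h : y ∈ convexHull ℝ (s : Set E)) :
    ∃ w, IsBarycentric s y w := by
  classical
  obtain ⟨w, h1, h2, h3⟩ := Finset.mem_convexHull'.1 h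
  refine ⟨fun v => if v ∈ s then w v else 0, fun v => ?_, fun v hv => if_neg hv, ?_, ?_⟩
  · by_cases hv : v ∈ s
    · simpa [hv] using h1 v hv
    · simp [hv]
  · rw [← h2]
    exact Finset.sum_congr rfl fun v hv => if_pos hv
  · rw [← h3]
    exact Finset.sum_congr rfl fun v hv => by simp [hv]

/-- Two simplices of the complex meet in the hull of their common vertices. Coordinates with respect
to these vertices, extended by zero, agree with both systems by affine independence. -/
theorem IsBarycentric.unique {s t : Finset E} (hs : s ∈ X.complex.faces) (ht : t ∈ X.complex.faces)
    {y : E} {w w' : E → ℝ} (h : IsBarycentric s y w) (h' : IsBarycentric t y w') : w = w' := by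
  classical
  have hst := X.complex.inter_subset_convexHull hs ht ⟨h.mem_convexHull, h'.mem_convexHull⟩
  rw [← Finset.coe_inter] at hst
  obtain ⟨u, hu⟩ := exists_isBarycentric hst
  have key : ∀ {r : Finset E} {z : E → ℝ}, r ∈ X.complex.faces → IsBarycentric r y z →
      s ∩ t ⊆ r → z = u := by
    intro r z hr hz hsub
    have hu' := hu.mono hsub
    funext v
    by_cases hv : v ∈ r
    · exact (X.complex.indep hr).weights_eq (hz.sum_eq_one.trans hu'.sum_eq_one.symm)
        (hz.sum_smul_eq.trans hu'.sum_smul_eq.symm) hv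
    · rw [hz.eq_zero v hv, hu'.eq_zero v hv]
  rw [key hs h Finset.inter_subset_left, key ht h' Finset.inter_subset_right]

theorem exists_bary (y : X) : ∃ w : E → ℝ, ∃ s ∈ X.complex.faces, IsBarycentric s y.1 w := by
  obtain ⟨s, hs, hy⟩ := Geometry.SimplicialComplex.mem_space_iff.1 y.2
  obtain ⟨w, hw⟩ := exists_isBarycentric hy
  exact ⟨w, s, hs, hw⟩

/-- The barycentric coordinates of a point of the polyhedron. -/
noncomputable def bary (y : X) : E → ℝ := (exists_bary y).choose

theorem bary_eq {y : X} {s : Finset E} (hs : s ∈ X.complex.faces) {w : E → ℝ}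
    (h : IsBarycentric s y.1 w) : bary y = w := by
  obtain ⟨t, ht, h'⟩ := (exists_bary y).choose_spec
  exact h'.unique ht hs h

theorem isBarycentric_bary {y : X} {s : Finset E} (hs : s ∈ X.complex.faces)
    (h : y.1 ∈ convexHull ℝ (s : Set E)) : IsBarycentric s y.1 (bary y) := by
  obtain ⟨w, hw⟩ := exists_isBarycentric h
  rwa [bary_eq hs hw]

theorem sum_facet (s : X.complex.facets) {M : Type*} [AddCommMonoid M] (F : E → M) :
    ∑ v ∈ (s : Finset E), F v = ∑ i, F (X.vertex s i) := by
  rw [← Finset.sum_coe_sort (s : Finset E) F]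
  exact ((X.vertex s).sum_comp fun v => F v).symm

theorem isBarycentric_point (s : X.complex.facets) (t : closedSimplex n) :
    ∃ w, IsBarycentric (s : Finset E) (X.point s t).1 w ∧ ∀ i, w (X.vertex s i) =
      Fin.cases (motive := fun _ => ℝ) (1 - ∑ j, t.1 j) (fun j => t.1 j) i := by
  classical
  let c : Fin (n + 1) → ℝ := fun i =>
    Fin.cases (motive := fun _ => ℝ) (1 - ∑ j, t.1 j) (fun j => t.1 j) i
  let w : E → ℝ := fun v => if h : v ∈ (s : Finset E) then c ((X.vertex s).symm ⟨v, h⟩) else 0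
  have hw : ∀ i, w (X.vertex s i) = c i := fun i => by simp [w]
  refine ⟨w, ⟨fun v => ?_, fun v hv => dif_neg hv, ?_, ?_⟩, hw⟩
  · by_cases h : v ∈ (s : Finset E)
    · simp only [w, dif_pos h]
      refine Fin.cases ?_ (fun j => ?_) ((X.vertex s).symm ⟨v, h⟩)
      · simpa [c] using t.2.2
      · simpa [c] using t.2.1 j
    · simp [w, h]
  · rw [sum_facet]
    simp [hw, c, Fin.sum_univ_succ]
  · rw [sum_facet]
    simp [hw, c, Fin.sum_univ_succ, point, chart]

/-- The barycentric coordinates of the point of `s` with coordinates `t`. -/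
theorem bary_point (s : X.complex.facets) (t : closedSimplex n) (i : Fin (n + 1)) :
    bary (X.point s t) (X.vertex s i) =
      Fin.cases (motive := fun _ => ℝ) (1 - ∑ j, t.1 j) (fun j => t.1 j) i := by
  obtain ⟨w, hw, h⟩ := isBarycentric_point s t
  rw [bary_eq (X.complex.facets_subset s.2) hw, h]

theorem point_mem_convexHull (s : X.complex.facets) (t : closedSimplex n) :
    (X.point s t).1 ∈ convexHull ℝ ((s : Finset E) : Set E) :=
  (isBarycentric_point s t).choose_spec.1.mem_convexHull

theorem exists_point_eq (s : X.complex.facets) {y : X}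
    (h : y.1 ∈ convexHull ℝ ((s : Finset E) : Set E)) : ∃ t, X.point s t = y := by
  obtain ⟨w, hw⟩ := exists_isBarycentric h
  have h1 := hw.sum_eq_one
  rw [sum_facet, Fin.sum_univ_succ] at h1
  have h2 := hw.sum_smul_eq
  rw [sum_facet, Fin.sum_univ_succ] at h2
  refine ⟨⟨WithLp.toLp 2 fun i => w (X.vertex s i.succ), fun i => hw.nonneg _, ?_⟩,
    Subtype.ext ?_⟩
  · show ∑ i : Fin n, w (X.vertex s i.succ) ≤ 1
    linarith [hw.nonneg (X.vertex s 0)]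
  · have h3 : 1 - ∑ i : Fin n, w (X.vertex s i.succ) = w (X.vertex s 0) := by linarith
    rw [← h3] at h2
    exact h2

theorem bary_point_of_notMem (s : X.complex.facets) (t : closedSimplex n) {v : E}
    (hv : v ∉ (s : Finset E)) : bary (X.point s t) v = 0 :=
  (isBarycentric_bary (X.complex.facets_subset s.2) (point_mem_convexHull s t)).eq_zero v hv

/-- Every face is contained in an `n`-simplex. -/
theorem exists_facet_superset {r : Finset E} (hr : r ∈ X.complex.faces) :
    ∃ s : X.complex.facets, r ⊆ s := by
  obtain ⟨v, hv⟩ := X.complex.nonempty_of_mem_faces hr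
  have hvv : v ∈ X.complex.vertices :=
    X.complex.down_closed hr (Finset.singleton_subset_iff.2 hv) (Finset.singleton_nonempty v)
  obtain ⟨s, hrs, hs⟩ := (X.locallyFinite v hvv).exists_le_maximal (a := r) ⟨hr, hv⟩
  refine ⟨⟨s, hs.prop.1, fun t ht hst => ?_⟩, hrs⟩
  exact hst.antisymm (hs.le_of_ge ⟨ht, hst hs.prop.2⟩ hst)

theorem mem_vertices_of_mem {s : Finset E} (hs : s ∈ X.complex.faces) {v : E} (hv : v ∈ s) :
    v ∈ X.complex.vertices :=
  X.complex.down_closed hs (Finset.singleton_subset_iff.2 hv) (Finset.singleton_nonempty v)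

theorem finite_facets_of_mem (v : E) : {s : X.complex.facets | v ∈ (s : Finset E)}.Finite := by
  by_cases hv : v ∈ X.complex.vertices
  · refine Finite.of_finite_image (f := Subtype.val) ((X.locallyFinite v hv).subset ?_)
      Subtype.val_injective.injOn
    rintro _ ⟨s, hs, rfl⟩
    exact ⟨X.complex.facets_subset s.2, hs⟩
  · convert finite_empty
    ext s
    simpa using fun hs => hv (mem_vertices_of_mem (X.complex.facets_subset s.2) hs)

theorem exists_lipschitzWith_bary_point (s : X.complex.facets) (v : E) :
    ∃ C : ℝ≥0, LipschitzWith C fun t => bary (X.point s t) v := by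
  by_cases hv : v ∈ (s : Finset E)
  · obtain ⟨i, hi⟩ := (X.vertex s).surjective ⟨v, hv⟩
    have hvi : v = X.vertex s i := by rw [hi]
    have hco : ∀ j, LipschitzWith 1 fun t : closedSimplex n => t.1 j := fun j =>
      LipschitzWith.of_dist_le_mul fun t t' => by
        rw [NNReal.coe_one, one_mul, Subtype.dist_eq, dist_eq_norm, dist_eq_norm, ← PiLp.sub_apply]
        exact PiLp.norm_apply_le _ _
    subst hvi
    simp only [bary_point]
    refine Fin.cases ?_ (fun j => ?_) i
    · refine ⟨n, LipschitzWith.of_dist_le_mul fun t t' => ?_⟩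
      simp only [Fin.cases_zero]
      rw [dist_sub_left, NNReal.coe_natCast]
      calc _ ≤ ∑ j, dist (t.1 j) (t'.1 j) := dist_sum_sum_le _ _ _
        _ ≤ ∑ _j : Fin n, dist t t' := Finset.sum_le_sum fun j _ => by
          simpa using (hco j).dist_le_mul t t'
        _ = _ := by simp
    · exact ⟨1, by simpa using hco j⟩
  · exact ⟨0, by simp only [bary_point_of_notMem s _ hv]; exact LipschitzWith.const 0⟩

/-- Barycentric coordinates are Lipschitz along the paths in a simplex. -/
theorem exists_edist_bary_le_length (s : X.complex.facets) (v : E) :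
    ∃ C : ℝ≥0, ∀ (y z : X) (γ : ℝ → EuclideanSpace ℝ (Fin n)), ContDiff ℝ 1 γ →
      (∀ r ∈ Ioo (0 : ℝ) 1, γ r ∈ openSimplex n) → X.chart s (γ 0) = y.1 → X.chart s (γ 1) = z.1 →
      edist (bary y v) (bary z v) ≤ C * X.length s γ := by
  obtain ⟨C₁, hC₁⟩ := exists_lipschitzWith_bary_point s v
  obtain ⟨C₂, hC₂⟩ := X.exists_norm_le s
  refine ⟨C₁ * C₂, fun y z γ hγ hin h0 h1 => ?_⟩
  have hmem : ∀ {r}, r ∈ Icc (0 : ℝ) 1 → γ r ∈ closedSimplex n :=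
    fun hr => mem_closedSimplex_of_path hγ.continuous hin hr
  have hy : y = X.point s ⟨γ 0, hmem (by simp)⟩ := Subtype.ext h0.symm
  have hz : z = X.point s ⟨γ 1, hmem (by simp)⟩ := Subtype.ext h1.symm
  have hle : edist (γ 0) (γ 1) ≤ C₂ * X.length s γ := by
    rw [edist_comm, edist_eq_enorm_sub]
    refine (enorm_sub_le_lintegral_derivWithin_Icc_of_contDiffOn_Icc hγ.contDiffOn
      zero_le_one).trans ?_
    rw [setLIntegral_congr Ioo_ae_eq_Icc.symm, length_eq,
      ← lintegral_const_mul' _ _ ENNReal.coe_ne_top]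
    refine setLIntegral_mono' measurableSet_Ioo fun r hr => ?_
    rw [derivWithin_of_mem_nhds (Icc_mem_nhds hr.1 hr.2), ← ofReal_norm, ← ENNReal.ofReal_coe_nnreal,
      ← ENNReal.ofReal_mul C₂.coe_nonneg]
    exact ENNReal.ofReal_le_ofReal (hC₂ _ (hin r hr) _)
  rw [hy, hz, ENNReal.coe_mul, mul_assoc]
  refine (hC₁ ⟨γ 0, hmem (by simp)⟩ ⟨γ 1, hmem (by simp)⟩).trans ?_
  gcongr
  exact hle

/-- The coordinate at `v` vanishes on simplices not containing `v`, and only finitely many contain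
it, so one constant serves all pieces of a path. -/
theorem exists_lipschitzWith_bary (v : E) : ∃ C : ℝ≥0, LipschitzWith C fun y : X => bary y v := by
  choose C hC using fun s : X.complex.facets => exists_edist_bary_le_length s v
  have hfin := finite_facets_of_mem (X := X) v
  -- The summand 1 keeps the constant nonzero, as is needed to move it past the infimum defining the
  -- distance.
  refine ⟨∑ s ∈ hfin.toFinset, C s + 1, ?_⟩
  set D := ∑ s ∈ hfin.toFinset, C s + 1
  have hpiece : ∀ {y z : X} {ℓ : ℝ≥0∞}, X.IsPiece y z ℓ →
      edist (bary y v) (bary z v) ≤ D * ℓ := by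
    rintro y z ℓ ⟨s, γ, hγ, hin, h0, h1, rfl⟩
    by_cases hv : v ∈ (s : Finset E)
    · refine (hC s y z γ hγ hin h0 h1).trans ?_
      gcongr
      refine le_add_of_le_of_nonneg ?_ zero_le
      exact Finset.single_le_sum (f := C) (fun _ _ => zero_le) (hfin.mem_toFinset.2 hv)
    · have hz : ∀ {y : X} {t}, t ∈ closedSimplex n → X.chart s t = y.1 → bary y v = 0 := by
        intro y t ht h
        rw [← bary_point_of_notMem s ⟨t, ht⟩ hv]
        congr 1
        exact Subtype.ext h.symm
      rw [hz (mem_closedSimplex_of_path hγ.continuous hin (by simp)) h0,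
        hz (mem_closedSimplex_of_path hγ.continuous hin (by simp)) h1]
      simp
  have hpath : ∀ {y z : X} {ℓ : ℝ≥0∞}, IsPathLength X y z ℓ →
      edist (bary y v) (bary z v) ≤ D * ℓ := by
    intro y z ℓ h
    induction h with
    | refl => simp
    | step _ h2 ih =>
      rw [mul_add]
      exact (edist_triangle _ _ _).trans (add_le_add ih (hpiece h2))
  intro y z
  show _ ≤ (D : ℝ≥0∞) * sInf {ℓ | IsPathLength X y z ℓ}
  rw [sInf_eq_iInf', ENNReal.mul_iInf_of_ne (by simp [D]) ENNReal.coe_ne_top]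
  exact le_iInf fun ℓ => hpath ℓ.2

/-- These are the open stars of the vertices. They cover the polyhedron, and each meets only
finitely many facets. -/
theorem isOpen_bary_pos (v : E) : IsOpen {y : X | 0 < bary y v} :=
  isOpen_lt continuous_const (exists_lipschitzWith_bary v).choose_spec.continuous

theorem exists_bary_pos (y : X) : ∃ v, 0 < bary y v := by
  obtain ⟨s, hs, hy⟩ := Geometry.SimplicialComplex.mem_space_iff.1 y.2
  have h := isBarycentric_bary hs hy
  by_contra! hcon
  have := h.sum_eq_one
  rw [Finset.sum_eq_zero fun v _ => le_antisymm (hcon v) (h.nonneg v)] at this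
  exact zero_ne_one this

theorem exists_mem_facet (y : X) : ∃ (s : X.complex.facets) (t : closedSimplex n),
    X.point s t = y := by
  obtain ⟨r, hr, hy⟩ := Geometry.SimplicialComplex.mem_space_iff.1 y.2
  obtain ⟨s, hrs⟩ := exists_facet_superset hr
  obtain ⟨t, ht⟩ := exists_point_eq s (convexHull_mono (Finset.coe_subset.2 hrs) hy)
  exact ⟨s, t, ht⟩

theorem mem_of_bary_point_pos {s : X.complex.facets} {t : closedSimplex n} {v : E}
    (h : 0 < bary (X.point s t) v) : v ∈ (s : Finset E) := by
  by_contra hv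
  rw [bary_point_of_notMem s t hv] at h
  exact h.false

theorem isCompact_range_point (s : X.complex.facets) : IsCompact (range (X.point s)) := by
  have := isCompact_iff_compactSpace.1 (isCompact_closedSimplex n)
  exact isCompact_range (exists_lipschitzWith_point s).choose_spec.continuous

/-- An open star lies in a finite union of closed simplices, each a continuous image of a compact
set. -/
instance : WeaklyLocallyCompactSpace X where
  exists_compact_mem_nhds y := by
    obtain ⟨v, hv⟩ := exists_bary_pos y
    refine ⟨_, (finite_facets_of_mem (X := X) v).isCompact_biUnion
      fun s _ => isCompact_range_point s, Filter.mem_of_superset ((isOpen_bary_pos v).mem_nhds hv) ?_⟩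
    intro z hz
    obtain ⟨s, t, rfl⟩ := exists_mem_facet z
    exact mem_iUnion₂.2 ⟨s, mem_of_bary_point_pos hz, mem_range_self t⟩

/-- A compact set meets only finitely many simplices. -/
theorem finite_facets_of_isCompact {K : Set X} (hK : IsCompact K) :
    {s : X.complex.facets | ∃ t, X.point s t ∈ K}.Finite := by
  obtain ⟨F, hF⟩ := hK.elim_finite_subcover (fun v : E => {y : X | 0 < bary y v}) isOpen_bary_pos
    fun y _ => mem_iUnion.2 (exists_bary_pos y)
  refine (F.finite_toSet.biUnion fun v _ => finite_facets_of_mem (X := X) v).subset ?_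
  rintro s ⟨t, ht⟩
  obtain ⟨v, hv, hp⟩ := mem_iUnion₂.1 (hF ht)
  exact mem_iUnion₂.2 ⟨v, hv, mem_of_bary_point_pos hp⟩

/-- Closed balls of a complete polyhedron are compact. -/
theorem isCompact_closedEBall [CompleteSpace X] (x : X) (r : ℝ) :
    IsCompact (Metric.closedEBall x (ENNReal.ofReal r)) :=
  isCompact_closedEBall_of_length_space exists_between_of_edist_lt x r

/-! ### Gradients in coordinates -/

theorem pull_apply (s : X.complex.facets) (f : X → ℝ) {t : EuclideanSpace ℝ (Fin n)}
    (ht : t ∈ closedSimplex n) : X.pull s f t = f (X.point s ⟨t, ht⟩) := dif_pos ht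

theorem exists_lipschitzOnWith_pull (s : X.complex.facets) {f : X → ℝ} (hf : LocallyLipschitz f) :
    ∃ K : ℝ≥0, LipschitzOnWith K (X.pull s f) (closedSimplex n) := by
  refine LocallyLipschitzOn.exists_lipschitzOnWith_of_compact (isCompact_closedSimplex n) ?_
  rw [locallyLipschitzOn_iff_restrict]
  obtain ⟨C, hC⟩ := exists_lipschitzWith_point s
  have h : (closedSimplex n).domRestrict (X.pull s f) = f ∘ X.point s :=
    funext fun t => pull_apply s f t.2
  exact h ▸ hf.comp hC.locallyLipschitz

/-- Rademacher's theorem. -/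
theorem ae_differentiableAt_pull (s : X.complex.facets) {f : X → ℝ} (hf : LocallyLipschitz f) :
    ∀ᵐ t, t ∈ openSimplex n → DifferentiableAt ℝ (X.pull s f) t := by
  obtain ⟨K, hK⟩ := exists_lipschitzOnWith_pull s hf
  filter_upwards [(hK.mono (openSimplex_subset n)).ae_differentiableWithinAt_of_mem] with t ht h
  exact (ht h).differentiableAt ((isOpen_openSimplex n).mem_nhds h)

theorem fderiv_apply_eq_partials (F : EuclideanSpace ℝ (Fin n) → ℝ)
    (t v : EuclideanSpace ℝ (Fin n)) : fderiv ℝ F t v = partials F t ⬝ᵥ v.ofLp := by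
  have hv : v = ∑ i, v i • EuclideanSpace.single i (1 : ℝ) := by
    ext j
    simp [Pi.single_apply]
  conv_lhs => rw [hv]
  simp [dotProduct, partials, mul_comm]

/-- The inner product of covectors at a point of a simplex. -/
noncomputable def coInner (X : RiemannianPolyhedron E n) (s : X.complex.facets)
    (t : EuclideanSpace ℝ (Fin n)) (a b : Fin n → ℝ) : ℝ := a ⬝ᵥ ((X.metric s t)⁻¹ *ᵥ b)

theorem gradInner_eq (s : X.complex.facets) (φ f : X → ℝ) (t : EuclideanSpace ℝ (Fin n)) :
    X.gradInner s φ f t = X.coInner s t (partials (X.pull s φ) t) (partials (X.pull s f) t) := rfl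

theorem coInner_add_left (s : X.complex.facets) (t : EuclideanSpace ℝ (Fin n))
    (a b c : Fin n → ℝ) : X.coInner s t (a + b) c = X.coInner s t a c + X.coInner s t b c :=
  add_dotProduct _ _ _

theorem coInner_smul_left (s : X.complex.facets) (t : EuclideanSpace ℝ (Fin n)) (r : ℝ)
    (a c : Fin n → ℝ) : X.coInner s t (r • a) c = r * X.coInner s t a c :=
  smul_dotProduct _ _ _

theorem coInner_comm (s : X.complex.facets) {t : EuclideanSpace ℝ (Fin n)}
    (ht : t ∈ openSimplex n) (a b : Fin n → ℝ) : X.coInner s t a b = X.coInner s t b a := by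
  have h : ((X.metric s t)⁻¹)ᵀ = (X.metric s t)⁻¹ := by
    rw [Matrix.transpose_nonsing_inv, X.metric_symm s t ht]
  rw [coInner, coInner, Matrix.dotProduct_mulVec, ← Matrix.mulVec_transpose, h, dotProduct_comm]

theorem coInner_self_pos (s : X.complex.facets) {t : EuclideanSpace ℝ (Fin n)}
    (ht : t ∈ openSimplex n) {a : Fin n → ℝ} (ha : a ≠ 0) : 0 < X.coInner s t a a := by
  have := (X.metric_posDef s ht).inv.dotProduct_mulVec_pos ha
  rwa [star_trivial] at this

theorem coInner_self_nonneg (s : X.complex.facets) {t : EuclideanSpace ℝ (Fin n)}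
    (ht : t ∈ openSimplex n) (a : Fin n → ℝ) : 0 ≤ X.coInner s t a a := by
  rcases eq_or_ne a 0 with rfl | ha
  · simp [coInner]
  · exact (coInner_self_pos s ht ha).le

/-- The expanded square of $\alpha a+\beta b$, from which the bound on mixed products and Young's
inequality are read off. -/
theorem coInner_combination_nonneg (s : X.complex.facets) {t : EuclideanSpace ℝ (Fin n)}
    (ht : t ∈ openSimplex n) (a b : Fin n → ℝ) (α β : ℝ) :
    0 ≤ α ^ 2 * X.coInner s t a a + 2 * α * β * X.coInner s t a b +
      β ^ 2 * X.coInner s t b b := by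
  have h := coInner_self_nonneg s ht (α • a + β • b)
  rw [coInner_add_left, coInner_smul_left, coInner_smul_left, coInner_comm s ht a,
    coInner_comm s ht b, coInner_add_left, coInner_add_left, coInner_smul_left, coInner_smul_left,
    coInner_smul_left, coInner_smul_left, coInner_comm s ht b a] at h
  linarith

/-- The norm of a covector is dual to the norm of tangent vectors. -/
theorem coInner_self_le (s : X.complex.facets) {t : EuclideanSpace ℝ (Fin n)}
    (ht : t ∈ openSimplex n) {a : Fin n → ℝ} {L : ℝ} (hL : 0 ≤ L)
    (h : ∀ v : EuclideanSpace ℝ (Fin n), a ⬝ᵥ v.ofLp ≤ L * X.tangentNorm s t v) :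
    X.coInner s t a a ≤ L ^ 2 := by
  have hdet : IsUnit (X.metric s t).det := (X.metric_posDef s ht).det_pos.ne'.isUnit
  have h1 := h (WithLp.toLp 2 ((X.metric s t)⁻¹ *ᵥ a))
  have h2 : X.tangentNorm s t (WithLp.toLp 2 ((X.metric s t)⁻¹ *ᵥ a)) =
      √(X.coInner s t a a) := by
    rw [tangentNorm, coInner, Matrix.mulVec_mulVec, Matrix.mul_nonsing_inv _ hdet,
      Matrix.one_mulVec, dotProduct_comm]
  rw [h2] at h1
  change X.coInner s t a a ≤ _ at h1
  have h0 := coInner_self_nonneg s ht a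
  have h3 := Real.sq_sqrt h0
  have h4 := Real.sqrt_nonneg (X.coInner s t a a)
  have h5 : √(X.coInner s t a a) ≤ L := by
    rcases h4.eq_or_lt with h | h
    · rwa [← h]
    · refine le_of_mul_le_mul_right ?_ h
      rw [← sq, h3]
      exact h1
  calc X.coInner s t a a = √(X.coInner s t a a) ^ 2 := h3.symm
    _ ≤ L ^ 2 := by gcongr

/-- By continuity of the metric, a short segment from `t` in direction `h • v` has length at most
$|h|(N+\eta)$, which bounds the difference quotient by $L(N+\eta)$. No ellipticity constant enters,
so the bound is uniform over all simplices. -/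
theorem abs_fderiv_pull_le (s : X.complex.facets) {ρ : X → ℝ} {L : ℝ≥0} (hρ : LipschitzWith L ρ)
    {t : EuclideanSpace ℝ (Fin n)} (ht : t ∈ openSimplex n)
    (hd : DifferentiableAt ℝ (X.pull s ρ) t) (v : EuclideanSpace ℝ (Fin n)) :
    |fderiv ℝ (X.pull s ρ) t v| ≤ L * X.tangentNorm s t v := by
  refine le_of_forall_pos_le_add fun ε hε => ?_
  set N := X.tangentNorm s t v
  have hN : 0 ≤ N := Real.sqrt_nonneg _
  obtain ⟨η, hη, hηε⟩ : ∃ η : ℝ, 0 < η ∧ L * (N + η) ≤ L * N + ε := by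
    -- Dividing by `L + 1` allows `L = 0`.
    refine ⟨ε / (L + 1), by positivity, ?_⟩
    have : L * (ε / (L + 1)) ≤ ε := by
      rw [mul_div_assoc', div_le_iff₀ (by positivity)]
      nlinarith [L.coe_nonneg]
    linarith
  refine le_trans ?_ hηε
  have hline : HasDerivAt (fun h : ℝ => t + h • v) v 0 := by
    simpa using ((hasDerivAt_id (0 : ℝ)).smul_const v).const_add t
  have hcomp : HasDerivAt (fun h : ℝ => X.pull s ρ (t + h • v)) (fderiv ℝ (X.pull s ρ) t v) 0 := by
    have hd' : HasFDerivAt (X.pull s ρ) (fderiv ℝ (X.pull s ρ) t) (t + (0 : ℝ) • v) := by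
      simpa using hd.hasFDerivAt
    exact hd'.comp_hasDerivAt (0 : ℝ) hline
  have hnear : ∀ᶠ z in nhds t, z ∈ openSimplex n ∧ X.tangentNorm s z v < N + η := by
    have ho := (isOpen_openSimplex n).mem_nhds ht
    refine (Filter.eventually_mem_set.2 ho).and ?_
    have hc := X.continuousOn_tangentNorm s (a := id) (v := fun _ => v) (S := openSimplex n)
      continuousOn_id continuousOn_const (mapsTo_id _)
    exact (hc.continuousAt ho).eventually_lt continuousAt_const (by simpa [N] using hη)
  obtain ⟨δ, hδ, hball⟩ := Metric.eventually_nhds_iff_ball.1 hnear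
  have hev : ∀ᶠ h : ℝ in nhds 0, t + h • v ∈ Metric.ball t δ := by
    refine hline.continuousAt.eventually ?_
    simp only [zero_smul, add_zero]
    exact Metric.ball_mem_nhds t hδ
  refine HasDerivAt.le_of_lip' hcomp (by positivity) ?_
  filter_upwards [hev] with h hh
  have hseg : ∀ r ∈ Ioo (0 : ℝ) 1, t + r • (t + h • v - t) ∈ Metric.ball t δ := fun r hr => by
    have := (convex_ball t δ) (Metric.mem_ball_self hδ) hh (sub_nonneg.2 hr.2.le) hr.1.le (by ring)
    convert this using 1
    module
  have htc := openSimplex_subset n ht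
  have hhc := openSimplex_subset n (hball _ hh).1
  have hle := edist_point_le_of_segment s htc hhc (fun r hr => (hball _ (hseg r hr)).1)
    (B := |h| * (N + η)) (fun r hr => by
      rw [add_sub_cancel_left, tangentNorm_smul]
      gcongr
      have := (hball _ (hseg r hr)).2
      rw [add_sub_cancel_left] at this
      exact this.le)
  simp only [zero_smul, add_zero]
  rw [pull_apply s ρ htc, pull_apply s ρ hhc, sub_zero, Real.norm_eq_abs h, ← dist_eq_norm,
    dist_comm]
  have h2 := (hρ _ _).trans (mul_le_mul_right hle (L : ℝ≥0∞))
  rw [edist_dist, ← ENNReal.ofReal_coe_nnreal, ← ENNReal.ofReal_mul L.coe_nonneg] at h2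
  have := (ENNReal.ofReal_le_ofReal_iff (by positivity)).1 h2
  linarith

/-- The gradient of an `L`-Lipschitz function has norm at most `L`. -/
theorem gradInner_self_le (s : X.complex.facets) {ρ : X → ℝ} {L : ℝ≥0} (hρ : LipschitzWith L ρ)
    {t : EuclideanSpace ℝ (Fin n)} (ht : t ∈ openSimplex n)
    (hd : DifferentiableAt ℝ (X.pull s ρ) t) : X.gradInner s ρ ρ t ≤ (L : ℝ) ^ 2 :=
  coInner_self_le s ht L.coe_nonneg fun v => by
    rw [← fderiv_apply_eq_partials]
    exact (le_abs_self _).trans (abs_fderiv_pull_le s hρ ht hd v)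

/-- Here the constant may depend on the simplex, so ellipticity and the Euclidean Lipschitz constant
suffice; only integrability is at stake. -/
theorem exists_gradInner_self_le (s : X.complex.facets) {f : X → ℝ} (hf : LocallyLipschitz f) :
    ∃ C : ℝ, ∀ t ∈ openSimplex n, X.gradInner s f f t ≤ C := by
  obtain ⟨K, hK⟩ := exists_lipschitzOnWith_pull s hf
  obtain ⟨C, hC⟩ := X.exists_norm_le s
  refine ⟨((K : ℝ) * C) ^ 2, fun t ht => coInner_self_le s ht (by positivity) fun v => ?_⟩
  rw [← fderiv_apply_eq_partials]
  have hb : ‖fderiv ℝ (X.pull s f) t‖ ≤ K := norm_fderiv_le_of_lipschitzOn ℝ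
    ((isOpen_openSimplex n).mem_nhds ht) (hK.mono (openSimplex_subset n))
  calc _ ≤ ‖fderiv ℝ (X.pull s f) t v‖ := le_abs_self _
    _ ≤ ‖fderiv ℝ (X.pull s f) t‖ * ‖v‖ := ContinuousLinearMap.le_opNorm _ _
    _ ≤ K * (C * X.tangentNorm s t v) := by gcongr; exact hC t ht v
    _ = _ := by ring

theorem exists_abs_gradInner_le (s : X.complex.facets) {φ f : X → ℝ} (hφ : LocallyLipschitz φ)
    (hf : LocallyLipschitz f) : ∃ C : ℝ, ∀ t ∈ openSimplex n, |X.gradInner s φ f t| ≤ C := by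
  obtain ⟨C₁, h₁⟩ := exists_gradInner_self_le s hφ
  obtain ⟨C₂, h₂⟩ := exists_gradInner_self_le s hf
  refine ⟨C₁ + C₂, fun t ht => ?_⟩
  have h1 := h₁ t ht
  have h2 := h₂ t ht
  rw [gradInner_eq] at h1 h2 ⊢
  have p := coInner_combination_nonneg s ht (partials (X.pull s φ) t) (partials (X.pull s f) t) 1 1
  have m :=
    coInner_combination_nonneg s ht (partials (X.pull s φ) t) (partials (X.pull s f) t) 1 (-1)
  have p1 := coInner_self_nonneg s ht (partials (X.pull s φ) t)
  have p2 := coInner_self_nonneg s ht (partials (X.pull s f) t)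
  rw [abs_le]
  constructor <;> linarith

theorem pull_nonneg (s : X.complex.facets) {f : X → ℝ} (hf0 : ∀ x, 0 ≤ f x)
    (t : EuclideanSpace ℝ (Fin n)) : 0 ≤ X.pull s f t := by
  unfold pull
  split_ifs
  · exact hf0 _
  · exact le_rfl

/-! ### Volume densities and integrability -/

theorem density_pos (s : X.complex.facets) {t : EuclideanSpace ℝ (Fin n)}
    (ht : t ∈ openSimplex n) : 0 < X.density s t :=
  Real.sqrt_pos.2 (X.metric_posDef s ht).det_pos

theorem density_nonneg (s : X.complex.facets) (t : EuclideanSpace ℝ (Fin n)) :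
    0 ≤ X.density s t := Real.sqrt_nonneg _

theorem continuousOn_density (s : X.complex.facets) :
    ContinuousOn (X.density s) (openSimplex n) := by
  have h := X.metric_continuous s
  rw [continuousOn_iff_continuous_domRestrict] at h ⊢
  exact h.matrix_det.sqrt

/-- Diagonal entries are values of the quadratic form at unit vectors; off-diagonal ones follow by
testing with $e_i\pm e_j$. -/
theorem exists_abs_metric_le (s : X.complex.facets) :
    ∃ C : ℝ, ∀ t ∈ openSimplex n, ∀ i j, |X.metric s t i j| ≤ C := by
  obtain ⟨c, hc, C, h⟩ := X.metric_elliptic s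
  refine ⟨2 * C, fun t ht i j => ?_⟩
  have hsym : X.metric s t j i = X.metric s t i j := (X.metric_symm s t ht).apply i j
  have hq : ∀ v : Fin n → ℝ, 0 ≤ v ⬝ᵥ (X.metric s t *ᵥ v) := fun v =>
    (mul_nonneg hc.le (dotProduct_self_star_nonneg v)).trans (h t ht v).1
  have hi := (h t ht (Pi.single i 1)).2
  have hj := (h t ht (Pi.single j 1)).2
  have hp := hq (Pi.single i 1 + Pi.single j 1)
  have hm := hq (Pi.single i 1 - Pi.single j 1)
  simp [Matrix.mulVec_add, Matrix.mulVec_sub, hsym] at hi hj hp hm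
  rw [abs_le]
  constructor <;> linarith

theorem exists_density_le (s : X.complex.facets) :
    ∃ C : ℝ, ∀ t ∈ openSimplex n, X.density s t ≤ C := by
  obtain ⟨C, hC⟩ := exists_abs_metric_le s
  refine ⟨√((Fintype.card (Fin n)).factorial • C ^ Fintype.card (Fin n)), fun t ht =>
    Real.sqrt_le_sqrt ((le_abs_self _).trans ?_)⟩
  exact Matrix.det_le (abv := AbsoluteValue.abs) fun i j => hC t ht i j

theorem measurableSet_openSimplex (n : ℕ) : MeasurableSet (openSimplex n) :=
  (isOpen_openSimplex n).measurableSet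

theorem volume_openSimplex_lt_top (n : ℕ) : volume (openSimplex n) < ⊤ :=
  (measure_mono (openSimplex_subset n)).trans_lt (isCompact_closedSimplex n).measure_lt_top

theorem integrableOn_mul_density (s : X.complex.facets) {h : EuclideanSpace ℝ (Fin n) → ℝ}
    (hm : AEStronglyMeasurable h (volume.restrict (openSimplex n))) {C : ℝ}
    (hC : ∀ t ∈ openSimplex n, |h t| ≤ C) :
    IntegrableOn (fun t => h t * X.density s t) (openSimplex n) := by
  obtain ⟨D, hD⟩ := exists_density_le s
  have : IsFiniteMeasure (volume.restrict (openSimplex n)) :=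
    ⟨by simpa using volume_openSimplex_lt_top n⟩
  refine Integrable.of_bound (C := C * D) (hm.mul
    ((continuousOn_density s).aestronglyMeasurable (measurableSet_openSimplex n))) ?_
  refine (ae_restrict_iff' (measurableSet_openSimplex n)).2 (Filter.Eventually.of_forall
    fun t ht => ?_)
  rw [norm_mul, Real.norm_eq_abs, Real.norm_eq_abs, abs_of_nonneg (density_nonneg s t)]
  exact mul_le_mul (hC t ht) (hD t ht) (density_nonneg s t) ((abs_nonneg _).trans (hC t ht))

theorem continuousOn_inv_metric (s : X.complex.facets) :
    ContinuousOn (fun t => (X.metric s t)⁻¹) (openSimplex n) := by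
  have h := X.metric_continuous s
  simp only [Matrix.inv_def, Ring.inverse_eq_inv']
  rw [continuousOn_iff_continuous_domRestrict] at h ⊢
  exact (h.matrix_det.inv₀ fun t => (X.metric_posDef s t.2).det_pos.ne').smul h.matrix_adjugate

/-- No regularity of `φ` and `f` is needed, since `fderiv` in a fixed direction is measurable for
every function. -/
theorem aestronglyMeasurable_gradInner (s : X.complex.facets) (φ f : X → ℝ) :
    AEStronglyMeasurable (X.gradInner s φ f) (volume.restrict (openSimplex n)) := by
  have hp : ∀ (h : X → ℝ) (i : Fin n), AEStronglyMeasurable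
      (fun t => partials (X.pull s h) t i) (volume.restrict (openSimplex n)) := fun h i =>
    (measurable_fderiv_apply_const ℝ _ _).aestronglyMeasurable
  have hg : ∀ i j : Fin n, AEStronglyMeasurable (fun t => (X.metric s t)⁻¹ i j)
      (volume.restrict (openSimplex n)) := fun i j =>
    ContinuousOn.aestronglyMeasurable ((continuous_apply_apply i j).comp_continuousOn
      (continuousOn_inv_metric s)) (measurableSet_openSimplex n)
  unfold gradInner
  simp only [dotProduct, Matrix.mulVec]
  exact Finset.aestronglyMeasurable_fun_sum _ fun i _ => (hp φ i).mul
    (Finset.aestronglyMeasurable_fun_sum _ fun j _ => (hg i j).mul (hp f j))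

theorem integrableOn_gradInner (s : X.complex.facets) {φ f : X → ℝ} (hφ : LocallyLipschitz φ)
    (hf : LocallyLipschitz f) :
    IntegrableOn (fun t => X.gradInner s φ f t * X.density s t) (openSimplex n) := by
  obtain ⟨C, hC⟩ := exists_abs_gradInner_le s hφ hf
  exact integrableOn_mul_density s (aestronglyMeasurable_gradInner s φ f) hC

theorem continuousOn_pull (s : X.complex.facets) {f : X → ℝ} (hf : LocallyLipschitz f) :
    ContinuousOn (X.pull s f) (closedSimplex n) :=
  (exists_lipschitzOnWith_pull s hf).choose_spec.continuousOn

theorem exists_abs_pull_le (s : X.complex.facets) {f : X → ℝ} (hf : LocallyLipschitz f) :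
    ∃ C : ℝ, ∀ t ∈ closedSimplex n, |X.pull s f t| ≤ C :=
  (isCompact_closedSimplex n).exists_bound_of_continuousOn (continuousOn_pull s hf)

theorem integrableOn_pull_rpow (s : X.complex.facets) {f : X → ℝ} (hf : LocallyLipschitz f)
    (hf0 : ∀ x, 0 ≤ f x) {p : ℝ} (hp : 0 < p) :
    IntegrableOn (fun t => X.pull s f t ^ p * X.density s t) (openSimplex n) := by
  obtain ⟨C, hC⟩ := exists_abs_pull_le s hf
  refine integrableOn_mul_density s (C := C ^ p) ?_ fun t ht => ?_
  · exact (((continuousOn_pull s hf).mono (openSimplex_subset n)).rpow_const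
      fun _ _ => Or.inr hp.le).aestronglyMeasurable (measurableSet_openSimplex n)
  · have h := hC t (openSimplex_subset n ht)
    rw [pull_apply s f (openSimplex_subset n ht)] at h ⊢
    rw [abs_of_nonneg (hf0 _)] at h
    rw [abs_of_nonneg (Real.rpow_nonneg (hf0 _) p)]
    exact Real.rpow_le_rpow (hf0 _) h hp.le

/-- For a function in `L^p` the integrals over the simplices are bounded. -/
theorem exists_sum_integral_rpow_le {f : X → ℝ} (hf : LocallyLipschitz f) (hf0 : ∀ x, 0 ≤ f x)
    {p : ℝ} (hp : 0 < p) (hLp : MemLp f (ENNReal.ofReal p) X.vol) :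
    ∃ M : ℝ, ∀ T : Finset X.complex.facets,
      ∑ s ∈ T, ∫ t in openSimplex n, X.pull s f t ^ p * X.density s t ≤ M := by
  have hfm : Measurable f := hf.continuous.measurable
  have h1 : ∫⁻ x, ‖f x‖ₑ ^ p ∂X.vol < ⊤ := by
    have := lintegral_rpow_enorm_lt_top_of_eLpNorm_lt_top (by simpa using hp)
      ENNReal.ofReal_ne_top hLp.2
    rwa [ENNReal.toReal_ofReal hp.le] at this
  have h2 : ∀ s : X.complex.facets,
      ENNReal.ofReal (∫ t in openSimplex n, X.pull s f t ^ p * X.density s t) =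
      ∫⁻ x, ‖f x‖ₑ ^ p ∂((((volume : Measure (EuclideanSpace ℝ (Fin n))).comap
        ((↑) : openSimplex n → EuclideanSpace ℝ (Fin n))).withDensity
        fun t => ENNReal.ofReal (X.density s t)).map
          fun t : openSimplex n => X.point s ⟨t.1, openSimplex_subset n t.2⟩) := by
    intro s
    have hpt : Measurable fun t : openSimplex n => X.point s ⟨t.1, openSimplex_subset n t.2⟩ :=
      ((exists_lipschitzWith_point s).choose_spec.continuous.comp
        (continuous_subtype_val.subtype_mk _)).measurable
    have hden : Measurable fun t : openSimplex n => ENNReal.ofReal (X.density s t) :=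
      (continuousOn_iff_continuous_domRestrict.1 (continuousOn_density s)).measurable.ennreal_ofReal
    rw [lintegral_map (by fun_prop) hpt, lintegral_withDensity_eq_lintegral_mul _ hden
      (by fun_prop), ofReal_integral_eq_lintegral_ofReal (integrableOn_pull_rpow s hf hf0 hp),
      ← lintegral_subtype_comap (measurableSet_openSimplex n)]
    · refine lintegral_congr fun t => ?_
      rw [pull_apply s f (openSimplex_subset n t.2), mul_comm,
        ENNReal.ofReal_mul (density_nonneg s _), ← ENNReal.ofReal_rpow_of_nonneg (hf0 _) hp.le,
        Pi.mul_apply, Real.enorm_of_nonneg (hf0 _)]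
    · refine (ae_restrict_iff' (measurableSet_openSimplex n)).2 (Filter.Eventually.of_forall
        fun t ht => ?_)
      exact mul_nonneg (Real.rpow_nonneg (pull_nonneg s hf0 t) p) (density_nonneg s t)
  rw [vol, lintegral_sum_measure] at h1
  simp only [← h2] at h1
  refine ⟨_, fun T => (ENNReal.ofReal_le_iff_le_toReal h1.ne).1 ?_⟩
  refine le_trans ?_ (ENNReal.sum_le_tsum T)
  exact Finset.le_sum_of_subadditive _ ENNReal.ofReal_zero.le (fun _ _ => ENNReal.ofReal_add_le) _ _

/-! ### The Caccioppoli inequality -/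

/-- The chain rule is not available at zeros of `F`, where `harmonicPower p` is controlled from one
side only. But such a zero is a minimum of `F`, so the derivative of `F` vanishes there and the
Lipschitz bound transfers this to the composition. -/
theorem hasFDerivAt_harmonicPower_comp {F : EuclideanSpace ℝ (Fin n) → ℝ} (hF : ∀ t, 0 ≤ F t)
    {p : ℝ} (hp : 1 < p) {t : EuclideanSpace ℝ (Fin n)} (hd : DifferentiableAt ℝ F t) :
    HasFDerivAt (fun t => harmonicPower p (F t)) (harmonicPowerDeriv p (F t) • fderiv ℝ F t) t := by
  rcases (hF t).eq_or_lt with h | h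
  · have hmin : IsLocalMin F t := Filter.Eventually.of_forall fun y => h ▸ hF y
    have h0 := hmin.fderiv_eq_zero
    have hd' := hd.hasFDerivAt
    rw [h0] at hd' ⊢
    rw [smul_zero]
    rw [hasFDerivAt_iff_isLittleO] at hd' ⊢
    refine (Asymptotics.IsBigO.of_bound (p.toNNReal : ℝ) (Filter.Eventually.of_forall
      fun y => ?_)).trans_isLittleO hd'
    simp only [_root_.zero_apply, sub_zero]
    exact (lipschitzOnWith_harmonicPower hp).norm_sub_le (hF y) (hF t)
  · exact (hasDerivAt_harmonicPower h).comp_hasFDerivAt t hd.hasFDerivAt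

/-- The test function of the Caccioppoli inequality. -/
noncomputable def testFunction (X : RiemannianPolyhedron E n) (p : ℝ) (ρ f : X → ℝ) (x : X) : ℝ :=
  ρ x ^ 2 * harmonicPower p (f x)

theorem locallyLipschitz_testFunction {p : ℝ} (hp : 1 < p) {ρ f : X → ℝ} (hρ : LocallyLipschitz ρ)
    (hf : LocallyLipschitz f) (hf0 : ∀ x, 0 ≤ f x) :
    LocallyLipschitz (X.testFunction p ρ f) := by
  have h1 : LocallyLipschitz fun x => harmonicPower p (f x) := by
    intro x
    obtain ⟨K, t, ht, hK⟩ := hf x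
    exact ⟨_, t, ht, (lipschitzOnWith_harmonicPower hp).comp hK fun y _ => hf0 y⟩
  have h2 : LocallyLipschitz fun q : ℝ × ℝ => q.1 ^ 2 * q.2 :=
    ContDiff.locallyLipschitz (𝕂 := ℝ) (by fun_prop)
  exact h2.comp (hρ.prodMk h1)

/-- The identity also holds outside the simplex, where `pull` is 0, because `harmonicPower p 0 = 0`.
-/
theorem pull_testFunction {p : ℝ} (hp : 1 < p) (s : X.complex.facets) (ρ f : X → ℝ) :
    X.pull s (X.testFunction p ρ f) =
      fun t => X.pull s ρ t ^ 2 * harmonicPower p (X.pull s f t) := by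
  funext t
  by_cases ht : t ∈ closedSimplex n
  · simp only [pull_apply s _ ht, testFunction]
  · simp only [pull, dif_neg ht, harmonicPower_zero hp, mul_zero]

theorem partials_testFunction {p : ℝ} (hp : 1 < p) (s : X.complex.facets) {ρ f : X → ℝ}
    (hf0 : ∀ x, 0 ≤ f x) {t : EuclideanSpace ℝ (Fin n)}
    (hρ : DifferentiableAt ℝ (X.pull s ρ) t) (hf : DifferentiableAt ℝ (X.pull s f) t) :
    partials (X.pull s (X.testFunction p ρ f)) t =
      (2 * X.pull s ρ t * harmonicPower p (X.pull s f t)) • partials (X.pull s ρ) t +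
      (X.pull s ρ t ^ 2 * harmonicPowerDeriv p (X.pull s f t)) • partials (X.pull s f) t := by
  have h := (hρ.hasFDerivAt.fun_mul hρ.hasFDerivAt).fun_mul
    (hasFDerivAt_harmonicPower_comp (pull_nonneg s hf0) hp hf)
  funext i
  rw [pull_testFunction hp]
  simp only [← sq] at h
  simp only [partials, h.fderiv, Pi.add_apply, Pi.smul_apply, smul_eq_mul, _root_.add_apply,
    _root_.smul_apply]
  ring

/-- The pointwise form of the Caccioppoli inequality. -/
theorem le_gradInner_testFunction {p : ℝ} (hp : 1 < p) (s : X.complex.facets) {ρ f : X → ℝ}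
    (hf0 : ∀ x, 0 ≤ f x) {L : ℝ≥0} (hL : LipschitzWith L ρ) {t : EuclideanSpace ℝ (Fin n)}
    (ht : t ∈ openSimplex n) (hρ : DifferentiableAt ℝ (X.pull s ρ) t)
    (hf : DifferentiableAt ℝ (X.pull s f) t) :
    X.pull s ρ t ^ 2 * harmonicPowerDeriv p (X.pull s f t) * X.gradInner s f f t / 2 -
      2 * L ^ 2 / (p - 1) * X.pull s f t ^ p ≤ X.gradInner s (X.testFunction p ρ f) f t := by
  have hp1 : 0 < p - 1 := by linarith
  have hB := gradInner_self_le s hL ht hρ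
  simp only [gradInner_eq] at hB ⊢
  rw [partials_testFunction hp s hf0 hρ hf, coInner_add_left, coInner_smul_left, coInner_smul_left]
  set a := partials (X.pull s ρ) t
  set b := partials (X.pull s f) t with hb
  set r := X.pull s ρ t
  rcases (pull_nonneg s hf0 t).eq_or_lt with h | h
  · have hmin : IsLocalMin (X.pull s f) t :=
      Filter.Eventually.of_forall fun y => h ▸ pull_nonneg s hf0 y
    have hb0 : b = 0 := by
      funext i
      simp [hb, partials, hmin.fderiv_eq_zero]
    rw [← h, hb0, harmonicPower_zero hp, Real.zero_rpow (by linarith)]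
    simp [coInner]
  · set F := X.pull s f t
    set k := harmonicPowerDeriv p F with hk
    set ψ := harmonicPower p F
    have hk0 : 0 < k := harmonicPowerDeriv_pos hp h
    have hψ : ψ ^ 2 ≤ F ^ p / (p - 1) * k := harmonicPower_sq_le hp h
    -- Divided by `2 * k`, this square is Young's inequality for the cross term $2r\psi\langle
    -- a,b\rangle$: it costs half the energy and $2(\psi^2/k)|a|^2$, which `h1` bounds.
    have hc := coInner_combination_nonneg s ht a b (2 * ψ) (r * k)
    have ha := coInner_self_nonneg s ht a
    have h1 : ψ ^ 2 * X.coInner s t a a ≤ F ^ p / (p - 1) * k * L ^ 2 :=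
      mul_le_mul hψ hB ha (by positivity)
    rw [← mul_le_mul_iff_right₀ (show 0 < 2 * k by positivity)]
    have h2 : 2 * L ^ 2 / (p - 1) * F ^ p = 2 * (F ^ p / (p - 1) * L ^ 2) := by ring
    rw [h2]
    nlinarith

/-- The density of the energy controlled by the Caccioppoli inequality is integrable. -/
theorem integrableOn_energy {p : ℝ} (hp : 1 < p) (s : X.complex.facets) {ρ f : X → ℝ}
    (hρ : LocallyLipschitz ρ) (hf : LocallyLipschitz f) (hf0 : ∀ x, 0 ≤ f x) :
    IntegrableOn (fun t => X.pull s ρ t ^ 2 * harmonicPowerDeriv p (X.pull s f t) *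
      X.gradInner s f f t * X.density s t) (openSimplex n) := by
  obtain ⟨C₁, h₁⟩ := exists_abs_pull_le s hρ
  obtain ⟨C₂, h₂⟩ := exists_abs_gradInner_le s hf hf
  have hmeas := measurableSet_openSimplex n
  have hkp : ∀ t, |harmonicPowerDeriv p (X.pull s f t)| ≤ p := fun t => by
    have h0 := pull_nonneg s hf0 t
    rw [abs_of_nonneg (harmonicPowerDeriv_nonneg hp h0)]
    rcases h0.eq_or_lt with h | h
    · rw [← h, harmonicPowerDeriv, harmonicPower_zero hp]
      simp only [ne_eq, OfNat.ofNat_ne_zero, not_false_eq_true, zero_pow, mul_zero]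
      linarith
    · exact harmonicPowerDeriv_le hp h
  refine integrableOn_mul_density s (C := C₁ ^ 2 * p * C₂) ?_ fun t ht => ?_
  · refine AEStronglyMeasurable.mul (AEStronglyMeasurable.mul ?_ ?_)
      (aestronglyMeasurable_gradInner s f f)
    · exact (((continuousOn_pull s hρ).mono (openSimplex_subset n)).pow 2).aestronglyMeasurable hmeas
    · exact (measurable_harmonicPowerDeriv.comp_aemeasurable
        (((continuousOn_pull s hf).mono (openSimplex_subset n)).aemeasurable
          hmeas)).aestronglyMeasurable
  · have hC₁ := h₁ t (openSimplex_subset n ht)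
    rw [abs_mul, abs_mul, abs_pow]
    have := hkp t
    have := h₂ t ht
    gcongr

/-- The Caccioppoli inequality on a single simplex. -/
theorem integral_energy_le {p : ℝ} (hp : 1 < p) (s : X.complex.facets) {ρ f : X → ℝ} {L : ℝ≥0}
    (hL : LipschitzWith L ρ) (hf : LocallyLipschitz f) (hf0 : ∀ x, 0 ≤ f x) :
    (∫ t in openSimplex n, X.pull s ρ t ^ 2 * harmonicPowerDeriv p (X.pull s f t) *
      X.gradInner s f f t * X.density s t) / 2 ≤
    (∫ t in openSimplex n, X.gradInner s (X.testFunction p ρ f) f t * X.density s t) +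
      2 * L ^ 2 / (p - 1) * ∫ t in openSimplex n, X.pull s f t ^ p * X.density s t := by
  have hρ := hL.locallyLipschitz
  have hG := integrableOn_gradInner s (locallyLipschitz_testFunction hp hρ hf hf0) hf
  have hF := integrableOn_pull_rpow s hf hf0 (by linarith : 0 < p)
  have hA := integrableOn_energy hp s hρ hf hf0
  rw [← integral_const_mul, ← integral_add hG (hF.const_mul _), ← integral_div]
  refine setIntegral_mono_on_ae (hA.div_const 2) (hG.add (hF.const_mul _))
    (measurableSet_openSimplex n) ?_
  filter_upwards [ae_differentiableAt_pull s hρ, ae_differentiableAt_pull s hf] with t h1 h2 ht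
  have h := le_gradInner_testFunction hp s hf0 hL ht (h1 ht) (h2 ht)
  have := mul_le_mul_of_nonneg_right h (density_nonneg s t)
  linarith

theorem integral_energy_nonneg {p : ℝ} (hp : 1 < p) (s : X.complex.facets) (ρ : X → ℝ) {f : X → ℝ}
    (hf0 : ∀ x, 0 ≤ f x) :
    0 ≤ ∫ t in openSimplex n, X.pull s ρ t ^ 2 * harmonicPowerDeriv p (X.pull s f t) *
      X.gradInner s f f t * X.density s t :=
  setIntegral_nonneg (measurableSet_openSimplex n) fun t ht => mul_nonneg (mul_nonneg (mul_nonneg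
    (sq_nonneg _) (harmonicPowerDeriv_nonneg hp (pull_nonneg s hf0 t)))
    (coInner_self_nonneg s ht _)) (density_nonneg s t)

theorem gradInner_eq_zero_of_forall (s : X.complex.facets) {φ : X → ℝ} (f : X → ℝ)
    (h : ∀ t, φ (X.point s t) = 0) (t : EuclideanSpace ℝ (Fin n)) : X.gradInner s φ f t = 0 := by
  have : X.pull s φ = fun _ => 0 := by
    funext t
    by_cases ht : t ∈ closedSimplex n
    · rw [pull_apply s φ ht, h]
    · exact dif_neg ht
  have h0 : partials (X.pull s φ) t = 0 := by
    funext i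
    simp [partials, this]
  rw [gradInner_eq, h0, coInner, zero_dotProduct]

/-- The Caccioppoli inequality. -/
theorem integral_energy_le_of_isWeaklySubharmonic {p : ℝ} (hp : 1 < p) {ρ f : X → ℝ} {L : ℝ≥0}
    (hL : LipschitzWith L ρ) (hc : HasCompactSupport ρ) (hf : LocallyLipschitz f)
    (hf0 : ∀ x, 0 ≤ f x) (hsub : X.IsWeaklySubharmonic f) {M : ℝ}
    (hM : ∀ T : Finset X.complex.facets,
      ∑ s ∈ T, ∫ t in openSimplex n, X.pull s f t ^ p * X.density s t ≤ M)
    (s : X.complex.facets) :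
    ∫ t in openSimplex n, X.pull s ρ t ^ 2 * harmonicPowerDeriv p (X.pull s f t) *
      X.gradInner s f f t * X.density s t ≤ 4 * L ^ 2 / (p - 1) * M := by
  classical
  have hp1 : 0 < p - 1 := by linarith
  set φ := X.testFunction p ρ f with hφ
  have hle := hsub φ (locallyLipschitz_testFunction hp hL.locallyLipschitz hf hf0)
    (by
      refine hc.mono fun x hx => ?_
      rw [Function.mem_support] at hx ⊢
      contrapose! hx
      simp [hφ, testFunction, hx])
    fun x => mul_nonneg (sq_nonneg _) (harmonicPower_nonneg (hf0 x))
  -- `s` is inserted so that its energy can be singled out even if it misses the support of `ρ`.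
  set T : Finset X.complex.facets :=
    insert s (finite_facets_of_isCompact (X := X) hc).toFinset with hT
  have hsum : X.dirichlet φ f =
      ∑ s ∈ T, ∫ t in openSimplex n, X.gradInner s φ f t * X.density s t := by
    refine tsum_eq_sum fun r hr => ?_
    have h0 : ∀ t, φ (X.point r t) = 0 := by
      intro t
      have : ρ (X.point r t) = 0 := by
        by_contra hne
        refine hr (Finset.mem_insert_of_mem ((Set.Finite.mem_toFinset _).2 ⟨t, ?_⟩))
        exact subset_tsupport _ hne
      simp [hφ, testFunction, this]
    simp [gradInner_eq_zero_of_forall r f h0]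
  rw [hsum] at hle
  have hall := Finset.sum_le_sum fun r (_ : r ∈ T) => integral_energy_le hp r hL hf hf0
  rw [Finset.sum_add_distrib, ← Finset.mul_sum] at hall
  have hsingle := Finset.single_le_sum (f := fun r => (∫ t in openSimplex n, X.pull r ρ t ^ 2 *
      harmonicPowerDeriv p (X.pull r f t) * X.gradInner r f f t * X.density r t) / 2)
    (fun r _ => div_nonneg (integral_energy_nonneg hp r ρ hf0) zero_le_two)
    (Finset.mem_insert_self s _ : s ∈ T)
  have hMT := mul_le_mul_of_nonneg_left (hM T)
    (by positivity : 0 ≤ 2 * (L : ℝ) ^ 2 / (p - 1))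
  have : 4 * (L : ℝ) ^ 2 / (p - 1) * M = 2 * (2 * (L : ℝ) ^ 2 / (p - 1) * M) := by ring
  rw [this]
  linarith

/-! ### Cutoff functions and vanishing of the gradient -/

/-- The points at finite distance from a given point form a clopen set. -/
theorem edist_lt_top [ConnectedSpace X] (x y : X) : edist x y < ⊤ := by
  have h : IsClopen (Metric.eball x ⊤) := ⟨Metric.isClosed_eball_top, Metric.isOpen_eball⟩
  have := h.eq_univ ⟨x, Metric.mem_eball_self ENNReal.zero_lt_top⟩
  have hy : y ∈ Metric.eball x ⊤ := this ▸ mem_univ y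
  rwa [edist_comm]

/-- A cutoff function with small gradient. -/
noncomputable def cutoff (x₀ : X) (R : ℝ) (x : X) : ℝ :=
  max 0 (min 1 (2 - R⁻¹ * (edist x x₀).toReal))

theorem lipschitzWith_toReal_edist [ConnectedSpace X] (x₀ : X) :
    LipschitzWith 1 fun x : X => (edist x x₀).toReal := by
  have key : ∀ x y : X, (edist x x₀).toReal ≤ (edist y x₀).toReal + (edist x y).toReal := by
    intro x y
    rw [← ENNReal.toReal_add (edist_lt_top _ _).ne (edist_lt_top _ _).ne, add_comm]
    exact ENNReal.toReal_mono (ENNReal.add_lt_top.2 ⟨edist_lt_top _ _, edist_lt_top _ _⟩).ne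
      (edist_triangle _ _ _)
  intro x y
  rw [ENNReal.coe_one, one_mul, edist_dist, ← ENNReal.ofReal_toReal (edist_lt_top x y).ne,
    Real.dist_eq]
  refine ENNReal.ofReal_le_ofReal (abs_sub_le_iff.2 ⟨?_, ?_⟩)
  · linarith [key x y]
  · have := key y x
    rw [edist_comm y x] at this
    linarith

theorem lipschitzWith_cutoff [ConnectedSpace X] (x₀ : X) {R : ℝ} (hR : 0 < R) :
    LipschitzWith (R⁻¹).toNNReal (cutoff x₀ R) := by
  have h1 : LipschitzWith (R⁻¹).toNNReal fun r : ℝ => 2 - R⁻¹ * r :=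
    LipschitzWith.of_dist_le_mul fun a b => by
      rw [dist_sub_left, Real.coe_toNNReal _ (by positivity), Real.dist_eq, Real.dist_eq, ← mul_sub,
        abs_mul, abs_of_pos (by positivity : 0 < R⁻¹)]
  have h2 := ((h1.comp (lipschitzWith_toReal_edist x₀)).const_min 1).const_max 0
  rw [mul_one] at h2
  exact h2

theorem hasCompactSupport_cutoff [ConnectedSpace X] [CompleteSpace X] (x₀ : X) {R : ℝ}
    (hR : 0 < R) : HasCompactSupport (cutoff x₀ R) := by
  refine (isCompact_closedEBall x₀ (2 * R)).of_isClosed_subset (isClosed_tsupport _)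
    (closure_minimal (fun x hx => ?_) Metric.isClosed_closedEBall)
  rw [Metric.mem_closedEBall, ← ENNReal.ofReal_toReal (edist_lt_top x x₀).ne]
  refine ENNReal.ofReal_le_ofReal ?_
  by_contra! hcon
  refine hx (max_eq_left ((min_le_right _ _).trans ?_))
  rw [inv_mul_eq_div, sub_nonpos, le_div_iff₀ hR]
  exact hcon.le

theorem cutoff_eq_one {x₀ x : X} {R : ℝ} (hR : 0 < R) (h : (edist x x₀).toReal ≤ R) :
    cutoff x₀ R x = 1 := by
  have : R⁻¹ * (edist x x₀).toReal ≤ 1 := by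
    rw [inv_mul_eq_div, div_le_one hR]
    exact h
  rw [cutoff, min_eq_left (by linarith), max_eq_right zero_le_one]

theorem ae_hasFDerivAt_pull_zero [ConnectedSpace X] [CompleteSpace X] {p : ℝ} (hp : 1 < p)
    {f : X → ℝ} (hf : LocallyLipschitz f) (hf0 : ∀ x, 0 ≤ f x) (hsub : X.IsWeaklySubharmonic f)
    (hLp : MemLp f (ENNReal.ofReal p) X.vol) (s : X.complex.facets) :
    ∀ᵐ t, t ∈ openSimplex n → HasFDerivAt (X.pull s f) (0 : _ →L[ℝ] ℝ) t := by
  have hp1 : 0 < p - 1 := by linarith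
  obtain ⟨M, hM⟩ := exists_sum_integral_rpow_le hf hf0 (by linarith) hLp
  obtain ⟨t₀, ht₀⟩ := openSimplex_nonempty n
  -- The centre lies in `s`, so the cutoff is identically 1 on `s` once `R ≥ D`.
  set x₀ := X.point s ⟨t₀, openSimplex_subset n ht₀⟩
  have hdist := (lipschitzWith_toReal_edist x₀).locallyLipschitz
  obtain ⟨D, hD⟩ := exists_abs_pull_le s hdist
  set A : EuclideanSpace ℝ (Fin n) → ℝ := fun t =>
    harmonicPowerDeriv p (X.pull s f t) * X.gradInner s f f t * X.density s t with hA
  have hmeas := measurableSet_openSimplex n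
  have hint : IntegrableOn A (openSimplex n) := by
    refine (integrableOn_energy hp s (LocallyLipschitz.const (1 : ℝ)) hf hf0).congr_fun
      (fun t ht => ?_) hmeas
    simp only [pull_apply s (fun _ => (1 : ℝ)) (openSimplex_subset n ht), hA]
    ring
  have hbound : ∀ R : ℝ, 0 < R → D ≤ R →
      ∫ t in openSimplex n, A t ≤ 4 * R⁻¹ ^ 2 / (p - 1) * M := by
    intro R hR hDR
    have h := integral_energy_le_of_isWeaklySubharmonic hp (lipschitzWith_cutoff x₀ hR)
      (hasCompactSupport_cutoff x₀ hR) hf hf0 hsub hM s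
    rw [Real.coe_toNNReal _ (by positivity)] at h
    refine le_trans (le_of_eq ?_) h
    refine setIntegral_congr_fun hmeas fun t ht => ?_
    have htc := openSimplex_subset n ht
    have h1 := hD t htc
    rw [pull_apply s _ htc] at h1
    simp only [pull_apply s (cutoff x₀ R) htc,
      cutoff_eq_one hR (((le_abs_self _).trans h1).trans hDR), hA]
    ring
  have hA0 : ∀ t ∈ openSimplex n, 0 ≤ A t := fun t ht => mul_nonneg (mul_nonneg
    (harmonicPowerDeriv_nonneg hp (pull_nonneg s hf0 t)) (coInner_self_nonneg s ht _))
    (density_nonneg s t)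
  have hle : ∫ t in openSimplex n, A t ≤ 0 := by
    have hlim : Filter.Tendsto (fun R : ℝ => 4 * R⁻¹ ^ 2 / (p - 1) * M) Filter.atTop
        (nhds (4 * 0 ^ 2 / (p - 1) * M)) :=
      (((tendsto_inv_atTop_zero.pow 2).const_mul 4).div_const _).mul_const _
    have := ge_of_tendsto hlim ((Filter.eventually_gt_atTop 0).mp
      ((Filter.eventually_ge_atTop D).mono fun R h1 h2 => hbound R h2 h1))
    simpa using this
  have hzero : ∫ t in openSimplex n, A t = 0 :=
    le_antisymm hle (setIntegral_nonneg hmeas hA0)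
  rw [setIntegral_eq_zero_iff_of_nonneg_ae
    ((ae_restrict_iff' hmeas).2 (Filter.Eventually.of_forall hA0)) hint,
    Filter.EventuallyEq, ae_restrict_iff' hmeas] at hzero
  filter_upwards [hzero, ae_differentiableAt_pull s hf] with t h1 h2 ht
  have hd := h2 ht
  suffices h : fderiv ℝ (X.pull s f) t = 0 from h ▸ hd.hasFDerivAt
  -- The weight `harmonicPowerDeriv` is known to be positive only where `f > 0`; a zero of `f` is a
  -- minimum, since `pull` is nonnegative on the whole space.
  rcases (pull_nonneg s hf0 t).eq_or_lt with h | h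
  · have hmin : IsLocalMin (X.pull s f) t :=
      Filter.Eventually.of_forall fun y => h ▸ pull_nonneg s hf0 y
    exact hmin.fderiv_eq_zero
  · have hg : X.gradInner s f f t = 0 := by
      have := h1 ht
      simpa [hA, (harmonicPowerDeriv_pos hp h).ne', (density_pos s ht).ne'] using this
    have hp0 : partials (X.pull s f) t = 0 := by
      by_contra hne
      exact (coInner_self_pos s ht hne).ne' hg
    ext v
    rw [fderiv_apply_eq_partials, hp0, zero_dotProduct, _root_.zero_apply]

end RiemannianPolyhedron

/-! ### Conclusion -/

theorem mainTheorem4 {E : Type*} [AddCommGroup E] [Module ℝ E] {n : ℕ}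
    (X : RiemannianPolyhedron E n) (hX : X.IsAdmissible) (hcomplete : CompleteSpace X)
    (p : ℝ) (hp : 1 < p) (f : X → ℝ) (hf : LocallyLipschitz f) (hf0 : ∀ x, 0 ≤ f x)
    (hsub : X.IsWeaklySubharmonic f) (hLp : MemLp f (ENNReal.ofReal p) X.vol) :
    ∃ c : ℝ, ∀ x, f x = c := by
  have := hX.connected
  have hconst : ∀ (s : X.complex.facets) (t t' : closedSimplex n),
      f (X.point s t) = f (X.point s t') := by
    intro s
    obtain ⟨K, hK⟩ := RiemannianPolyhedron.exists_lipschitzOnWith_pull s hf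
    obtain ⟨t₀, ht₀⟩ := openSimplex_nonempty n
    have hopen : ∀ t ∈ openSimplex n, X.pull s f t = X.pull s f t₀ := fun t ht =>
      (hK.mono (openSimplex_subset n)).eq_of_ae_fderiv_eq_zero (isOpen_openSimplex n)
        (convex_openSimplex n)
        (RiemannianPolyhedron.ae_hasFDerivAt_pull_zero hp hf hf0 hsub hLp s) ht ht₀
    have hclosed : ∀ t : closedSimplex n, f (X.point s t) = X.pull s f t₀ := fun t => by
      rw [← RiemannianPolyhedron.pull_apply s f t.2]
      have heq : EqOn (X.pull s f) (fun _ => X.pull s f t₀) (closedSimplex n) :=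
        EqOn.of_subset_closure (s := openSimplex n) hopen hK.continuousOn continuousOn_const
          (openSimplex_subset n) (closedSimplex_subset_closure n)
      exact heq t.2
    intro t t'
    rw [hclosed, hclosed]
  -- Each piece has both endpoints in one closed simplex, so constancy on simplices propagates along
  -- a path without any compatibility of the metrics.
  have hpath : ∀ {x y : X} {ℓ : ℝ≥0∞}, RiemannianPolyhedron.IsPathLength X x y ℓ →
      f x = f y := by
    intro x y ℓ h
    induction h with
    | refl => rfl
    | step _ h2 ih =>
      obtain ⟨s, γ, hγ, hin, h0, h1, -⟩ := h2
      have m0 := RiemannianPolyhedron.mem_closedSimplex_of_path hγ.continuous hin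
        (show (0 : ℝ) ∈ Icc (0 : ℝ) 1 by simp)
      have m1 := RiemannianPolyhedron.mem_closedSimplex_of_path hγ.continuous hin
        (show (1 : ℝ) ∈ Icc (0 : ℝ) 1 by simp)
      have := hconst s ⟨γ 0, m0⟩ ⟨γ 1, m1⟩
      rw [ih]
      convert this using 2
      · exact Subtype.ext h0.symm
      · exact Subtype.ext h1.symm
  obtain ⟨x₀⟩ : Nonempty X := inferInstance
  refine ⟨f x₀, fun x => ?_⟩
  obtain ⟨ℓ, -, h⟩ := RiemannianPolyhedron.exists_isPathLength_of_edist_lt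
    (RiemannianPolyhedron.edist_lt_top x x₀)
  exact hpath h
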